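/- A probabilistic weighted automaton over a finite alphabet $\Sigma$ consists of a finite set $Q$ of states, an initial probability distribution $\rho_I$ on $Q$, a probabilistic transition function $\delta$ assigning to each $(q,\sigma)\in Q\times\Sigma$ a probability distribution on $Q$, and a weight function $\gamma: Q\times\Sigma\times Q\to\mathbb{Q}$. For an infinite word $w=\sigma_1\sigma_2\dots\in\Sigma^\omega$, a run of $A$ over $w$ is a sequence of states $r=q_0q_1q_2\dots$ with $\rho_I(q_0)>0$ and $\delta(q_i,\sigma_{i+1})(q_{i+1})>0$ for all $i\ge 0$; its weight sequence is $\gamma(r)=v_0v_1\dots$ with $v_i=\gamma(q_i,\sigma_{i+1},q_{i+1})$. Let $\mathbb{P}^A$ be the unique probability measure on the runs over $w$ that gives the set of runs with prefix $q_0q_1\dots q_k$ the probability $\rho_I(q_0)\prod_{i=1}^{k}\delta(q_{i-1},\sigma_i)(q_i)$. For a value function $\mathsf{Val}\in\{\mathsf{LimSup},\mathsf{LimInf}\}$, where $\mathsf{LimSup}(v)=\limsup_{n\to\infty}v_n$ and $\mathsf{LimInf}(v)=\liminf_{n\to\infty}v_n$, the automaton $A$ defines the quantitative language $\Sigma^\omega\to\mathbb{R}$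 $$L^{=1}_A(w)=\sup\{\eta\in\mathbb{R} \mid \mathbb{P}^A(\{r \mid \mathsf{Val}(\gamma(r))\ge\eta\})=1\}$$ under the almost-sure semantics, and $$L^{>0}_A(w)=\sup\{\eta\in\mathbb{R} \mid \mathbb{P}^A(\{r \mid \mathsf{Val}(\gamma(r))\ge\eta\})>0\}$$ under the positive semantics. The classes AsLimSup and AsLimInf (resp. PosLimSup and PosLimInf) consist of the probabilistic weighted automata, over arbitrary finite alphabets, read with $\mathsf{Val}=\mathsf{LimSup}$ and $\mathsf{Val}=\mathsf{LimInf}$ under the almost-sure (resp. positive) semantics. A class $\mathcal{C}$ is reducible to a class $\mathcal{C}'$ if for every automaton $A\in\mathcal{C}$ there is an automaton $A'\in\mathcal{C}'$ over the same alphabet with $L_A(w)=L_{A'}(w)$ for all infinite words $w$. Two classes have incomparable expressive power if neither is reducible to the other. Lemma. AsLimInf and PosLimSup are reducible to each other, whereas AsLimSup and PosLimInf have incomparable expressive power. -/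

import Mathlib

open MeasureTheory ProbabilityTheory Filter
open scoped ENNReal

/-- A probabilistic weighted automaton over the alphabet `α`: a finite set of states, an initial
distribution, a probabilistic transition function and a rational weight function. -/
structure ProbWeightedAutomaton (α : Type) where
  /-- states -/
  Q : Type
  /-- finiteness of the set of states -/
  finite_Q : Finite Q
  /-- initial distribution `ρ_I` -/
  init : PMF Q
  /-- probabilistic transition function `δ` -/
  trans : Q → α → PMF Q
  /-- weight function `γ` -/
  weight : Q → α → Q → ℚ

namespace ProbWeightedAutomaton

variable {α : Type}

instance instFiniteStates (A : ProbWeightedAutomaton α) : Finite A.Q := A.finite_Q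

/-- The finite state space carries the discrete σ-algebra; the sequences of states `ℕ → A.Q` then
carry the product σ-algebra, generated by the cylinders. -/
instance instMeasurableSpaceStates (A : ProbWeightedAutomaton α) : MeasurableSpace A.Q := ⊤

instance instDiscreteStates (A : ProbWeightedAutomaton α) : DiscreteMeasurableSpace A.Q :=
  ⟨fun _ => trivial⟩

/-- `r` is a run over the infinite word `w`. The word `σ₁ σ₂ …` is coded by `w n = σ_{n+1}`, and
the run `q₀ σ₁ q₁ σ₂ …` by its sequence of states `r n = q_n`. -/
def IsRun (A : ProbWeightedAutomaton α) (w : ℕ → α) (r : ℕ → A.Q) : Prop :=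
  0 < A.init (r 0) ∧ ∀ n, 0 < A.trans (r n) (w n) (r (n + 1))

/-- The sequence of weights that occur along a run. -/
def weights (A : ProbWeightedAutomaton α) (w : ℕ → α) (r : ℕ → A.Q) : ℕ → ℚ :=
  fun n => A.weight (r n) (w n) (r (n + 1))

/-- The law of the state at time `n + 1`, given the states up to time `n`. -/
noncomputable def step (A : ProbWeightedAutomaton α) (w : ℕ → α) (n : ℕ) :
    Kernel ((i : Finset.Iic n) → (fun _ : ℕ => A.Q) i) A.Q where
  toFun h := (A.trans (h ⟨n, Finset.mem_Iic.2 le_rfl⟩) (w n)).toMeasure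
  measurable' := by
    have h : Measurable fun q : A.Q => (A.trans q (w n)).toMeasure := measurable_of_finite _
    exact h.comp (measurable_pi_apply _)

instance instMarkovStep (A : ProbWeightedAutomaton α) (w : ℕ → α) (n : ℕ) :
    IsMarkovKernel (A.step w n) :=
  ⟨fun _ => PMF.toMeasure.isProbabilityMeasure _⟩

/-- The probability measure of the automaton on infinite sequences of states, given the word `w`:
start with the initial distribution and follow the transition function. -/
noncomputable def runMeasure (A : ProbWeightedAutomaton α) (w : ℕ → α) : Measure (ℕ → A.Q) :=
  Kernel.trajMeasure (X := fun _ : ℕ => A.Q) A.init.toMeasure (A.step w)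

instance instProbRunMeasure (A : ProbWeightedAutomaton α) (w : ℕ → α) :
    IsProbabilityMeasure (A.runMeasure w) := by
  have : IsProbabilityMeasure A.init.toMeasure := PMF.toMeasure.isProbabilityMeasure _
  unfold runMeasure
  infer_instance

/-- The probability of a cylinder is the probability of the finite run that spans it, so `runMeasure`
is the unique probability measure determined by the probabilities of the finite runs. -/
theorem runMeasure_cylinder (A : ProbWeightedAutomaton α) (w : ℕ → α) (q : ℕ → A.Q) (k : ℕ) :
    A.runMeasure w {r | ∀ i ≤ k, r i = q i} =
      A.init (q 0) * ∏ i ∈ Finset.range k, A.trans (q i) (w i) (q (i + 1)) := by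
  have : IsProbabilityMeasure A.init.toMeasure := PMF.toMeasure.isProbabilityMeasure _
  induction k with
  | zero =>
    have e : {r : ℕ → A.Q | ∀ i ≤ 0, r i = q i} = (fun r => r 0) ⁻¹' {q 0} := by
      ext r; simp
    have key : (A.runMeasure w).map (fun r : ℕ → A.Q => r 0) = A.init.toMeasure := by
      have hf : (fun r : ℕ → A.Q => r 0) =
        (MeasurableEquiv.piUnique (fun i : Finset.Iic 0 => (fun _ : ℕ => A.Q) i)) ∘ (Preorder.frestrictLe (π := fun _ => A.Q) 0) := by
          ext r; rfl
      rw [hf, ← Measure.map_map (by fun_prop) (by fun_prop), runMeasure, Kernel.trajMeasure, Measure.map_comp _ _ (by fun_prop), Kernel.traj_map_frestrictLe, Kernel.partialTraj_self, Measure.id_comp, Measure.map_map (by fun_prop) (by fun_prop)]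
      simp only [MeasurableEquiv.self_comp_symm, Measure.map_id]
    rw [e, ← Measure.map_apply (by fun_prop) (measurableSet_singleton _), key, PMF.toMeasure_apply_singleton _ _ (measurableSet_singleton _)]
    simp
  | succ k ih =>
    have h := Kernel.map_frestrictLe_trajMeasure_compProd_eq_map_trajMeasure (X := fun _ : ℕ => A.Q) (μ₀ := A.init.toMeasure) (κ := A.step w) (a := k)
    have h2 := congrArg (fun m => m ({Preorder.frestrictLe (π := fun _ => A.Q) k q} ×ˢ {q (k+1)})) h
    have ms : MeasurableSet ({Preorder.frestrictLe (π := fun _ => A.Q) k q} : Set _) := measurableSet_singleton _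
    rw [Measure.compProd_apply_prod ms (measurableSet_singleton _), lintegral_singleton, Measure.map_apply (by fun_prop) ms, Measure.map_apply (by fun_prop) (ms.prod (measurableSet_singleton _))] at h2
    have e1 : Preorder.frestrictLe (π := fun _ => A.Q) k ⁻¹' {Preorder.frestrictLe (π := fun _ => A.Q) k q} = {r | ∀ i ≤ k, r i = q i} := by
      ext r; simp [funext_iff]
    have e2 : (fun x : ℕ → A.Q => (Preorder.frestrictLe (π := fun _ => A.Q) k x, x (k + 1))) ⁻¹' ({Preorder.frestrictLe (π := fun _ => A.Q) k q} ×ˢ {q (k+1)}) = {r | ∀ i ≤ k+1, r i = q i} := by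
      ext r; simp [funext_iff, Nat.le_succ_iff, or_imp, forall_and]
    rw [e1, e2] at h2
    have e3 : A.step w k (Preorder.frestrictLe (π := fun _ => A.Q) k q) {q (k+1)} = A.trans (q k) (w k) (q (k+1)) := 
      PMF.toMeasure_apply_singleton _ _ (measurableSet_singleton _)
    rw [e3] at h2
    unfold runMeasure at ih ⊢
    rw [← h2, ih, Finset.prod_range_succ]
    ring

/-- The almost-sure semantics for a value function `Val`. -/
noncomputable def almostSureLang (Val : (ℕ → ℚ) → ℝ) (A : ProbWeightedAutomaton α) (w : ℕ → α) :
    ℝ :=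
  sSup {η : ℝ | A.runMeasure w {r | A.IsRun w r ∧ η ≤ Val (A.weights w r)} = 1}

/-- The positive semantics for a value function `Val`. -/
noncomputable def positiveLang (Val : (ℕ → ℚ) → ℝ) (A : ProbWeightedAutomaton α) (w : ℕ → α) :
    ℝ :=
  sSup {η : ℝ | 0 < A.runMeasure w {r | A.IsRun w r ∧ η ≤ Val (A.weights w r)}}

end ProbWeightedAutomaton

/-- The value function `LimSup`. -/
noncomputable def LimSup (v : ℕ → ℚ) : ℝ := limsup (fun n => (v n : ℝ)) atTop

/-- The value function `LimInf`. -/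
noncomputable def LimInf (v : ℕ → ℚ) : ℝ := liminf (fun n => (v n : ℝ)) atTop

/-- A class of probabilistic weighted automata (all alphabets together), given by the semantics
that assigns to each automaton its quantitative language. -/
abbrev AutomataClass : Type 1 :=
  (α : Type) → ProbWeightedAutomaton α → (ℕ → α) → ℝ

/-- LimSup-automata under the almost-sure semantics. -/
noncomputable def AsLimSup : AutomataClass := fun _ A => A.almostSureLang LimSup

/-- LimInf-automata under the almost-sure semantics. -/
noncomputable def AsLimInf : AutomataClass := fun _ A => A.almostSureLang LimInf

/-- LimSup-automata under the positive semantics. -/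
noncomputable def PosLimSup : AutomataClass := fun _ A => A.positiveLang LimSup

/-- LimInf-automata under the positive semantics. -/
noncomputable def PosLimInf : AutomataClass := fun _ A => A.positiveLang LimInf

/-- `C` is reducible to `C'`: for every automaton of `C`, over any finite alphabet, there is an
automaton of `C'` over the same alphabet with the same quantitative language. -/
def Reducible (C C' : AutomataClass) : Prop :=
  ∀ (α : Type) [Finite α] (A : ProbWeightedAutomaton α),
    ∃ A' : ProbWeightedAutomaton α, ∀ w : ℕ → α, C α A w = C' α A' w

/-- Neither class is reducible to the other. -/
def Incomparable (C C' : AutomataClass) : Prop :=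
  ¬ Reducible C C' ∧ ¬ Reducible C' C

/-! Negating all weights exchanges the two semantics and the two value functions: the positive
LimSup value of `A` is minus the almost-sure LimInf value of `A.neg`, and likewise with LimSup and
LimInf exchanged (`positiveLang_LimSup`, `positiveLang_LimInf`). The mutual reducibility therefore
amounts to closure of PosLimSup under negation, which `exists_positiveLang_LimSup_eq_neg` provides.

To negate, let independent noise move all states at once, so that the runs become paths of a random
flow on a finite set. If runs almost surely exceed a weight only finitely often, then almost surely
so does every path from a reachable state; otherwise a zero-one law makes some path exceed it
infinitely often almost surely (`ae_forall_notMem_exceeds`, `ae_exists_mem_exceeds`). The dual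
automaton tests which case holds. It guesses a weight, a time and a set of paths, follows this set,
and signals a breakpoint each time all other tracked paths have merged into it. Infinitely many
breakpoints certify that all paths are eventually good (`BreakpointEvolution.eventually_not_bad`).
Conversely, a largest set of paths that never coalesce is a guess that works
(`exists_frequently_breakpoint`), and it is made with positive probability.

The incomparability is topological. For a positive LimInf automaton the words above a threshold form
an `F_σ` (`exists_isClosed_iUnion_eq`), whereas an AsLimSup automaton with one state detects
infinitely many `true`, which is not an `F_σ` by Baire. Negation gives the other direction. -/

/-! ### Limits of sequences with finitely many values. -/

section ValueFunctions

variable {v : ℕ → ℚ}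

/-- The gap turns a strict bound on terms from a finite set into a uniform non-strict one, so strict
inequalities survive the passage to the limit. -/
lemma exists_gap_above {S : Set ℝ} (hS : S.Finite) (a : ℝ) : ∃ b, a < b ∧ ∀ x ∈ S, a < x → b ≤ x := by
  by_cases h : (S ∩ Set.Ioi a).Nonempty
  · obtain ⟨b, hb, hmin⟩ := Set.exists_min_image _ id (hS.inter_of_left (Set.Ioi a)) h
    exact ⟨b, hb.2, fun x hx hax => hmin x ⟨hx, hax⟩⟩
  · refine ⟨a + 1, by linarith, fun x hx hax => absurd ⟨x, hx, hax⟩ h⟩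

lemma finite_range_cast (hv : (Set.range v).Finite) : (Set.range fun n => (v n : ℝ)).Finite := by
  have : (Set.range fun n => (v n : ℝ)) = (fun q : ℚ => (q : ℝ)) '' Set.range v := by
    rw [← Set.range_comp]; rfl
  rw [this]; exact hv.image _

lemma isBoundedUnder_le_of_finite_range (hv : (Set.range v).Finite) :
    IsBoundedUnder (· ≤ ·) atTop fun n => (v n : ℝ) :=
  (finite_range_cast hv).bddAbove.isBoundedUnder_of_range

lemma isBoundedUnder_ge_of_finite_range (hv : (Set.range v).Finite) :
    IsBoundedUnder (· ≥ ·) atTop fun n => (v n : ℝ) :=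
  (finite_range_cast hv).bddBelow.isBoundedUnder_of_range

lemma lt_LimInf_iff (hv : (Set.range v).Finite) (η : ℝ) :
    η < LimInf v ↔ ∀ᶠ n in atTop, η < v n := by
  constructor
  · intro h
    exact eventually_lt_of_lt_liminf h (isBoundedUnder_ge_of_finite_range hv)
  · intro h
    obtain ⟨b, hb, hgap⟩ := exists_gap_above (finite_range_cast hv) η
    refine hb.trans_le (le_liminf_of_le ?_ ?_)
    · exact (isBoundedUnder_le_of_finite_range hv).isCoboundedUnder_ge
    · filter_upwards [h] with n hn using hgap _ ⟨n, rfl⟩ hn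

lemma lt_LimSup_iff (hv : (Set.range v).Finite) (η : ℝ) :
    η < LimSup v ↔ ∃ᶠ n in atTop, η < v n := by
  constructor
  · intro h
    exact frequently_lt_of_lt_limsup (isBoundedUnder_ge_of_finite_range hv).isCoboundedUnder_le h
  · intro h
    obtain ⟨b, hb, hgap⟩ := exists_gap_above (finite_range_cast hv) η
    refine hb.trans_le (le_limsup_of_frequently_le ?_ (isBoundedUnder_le_of_finite_range hv))
    exact h.mono fun n hn => hgap _ ⟨n, rfl⟩ hn

lemma LimSup_neg (hv : (Set.range v).Finite) : LimSup (fun n => -v n) = -LimInf v := by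
  have hanti : Antitone fun x : ℝ => -x := fun _ _ => neg_le_neg
  have h := hanti.map_liminf_of_continuousAt
    (F := atTop) (fun n => (v n : ℝ)) continuous_neg.continuousAt
    (isBoundedUnder_le_of_finite_range hv).isCoboundedUnder_ge (isBoundedUnder_ge_of_finite_range hv)
  rw [LimInf, h, LimSup]
  congr 1; ext n; simp

lemma finite_range_neg (hv : (Set.range v).Finite) : (Set.range fun n => -v n).Finite := by
  have : (Set.range fun n => -v n) = Neg.neg '' Set.range v := by rw [← Set.range_comp]; rfl
  rw [this]; exact hv.image _

lemma LimInf_neg (hv : (Set.range v).Finite) : LimInf (fun n => -v n) = -LimSup v := by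
  have h := LimSup_neg (finite_range_neg hv)
  simp only [neg_neg] at h
  rw [h, neg_neg]

lemma le_LimInf_iff (hv : (Set.range v).Finite) (η : ℝ) :
    η ≤ LimInf v ↔ ∀ᶠ n in atTop, η ≤ v n := by
  have h := lt_LimSup_iff (finite_range_neg hv) (-η)
  rw [LimSup_neg hv, neg_lt_neg_iff] at h
  rw [← not_lt, h, not_frequently]
  refine eventually_congr (Eventually.of_forall fun n => ?_)
  push_cast
  rw [neg_lt_neg_iff, not_lt]

lemma le_LimSup_iff (hv : (Set.range v).Finite) (η : ℝ) :
    η ≤ LimSup v ↔ ∃ᶠ n in atTop, η ≤ v n := by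
  have h := lt_LimInf_iff (finite_range_neg hv) (-η)
  rw [LimInf_neg hv, neg_lt_neg_iff] at h
  rw [← not_lt, h, not_eventually]
  refine frequently_congr (Eventually.of_forall fun n => ?_)
  push_cast
  rw [neg_lt_neg_iff, not_lt]

end ValueFunctions

/-! ### Coalescing flows on a finite set and breakpoints. -/

section CoalescingFlow

variable {Q : Type*} {f : ℕ → Q → Q} {S T B : ℕ → Set Q} {bad : ℕ → Q → Prop}

/-- The composition `f (n + j - 1) ∘ ⋯ ∘ f n`. -/
def flow (f : ℕ → Q → Q) (n : ℕ) : ℕ → Q → Q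
  | 0 => id
  | j + 1 => f (n + j) ∘ flow f n j

lemma flow_add (n i j : ℕ) (q : Q) : flow f n (i + j) q = flow f (n + i) j (flow f n i q) := by
  induction j with
  | zero => rfl
  | succ j ih =>
    have : flow f n (i + (j + 1)) q = f (n + (i + j)) (flow f n (i + j) q) := rfl
    rw [this, ih, ← add_assoc]; rfl

lemma flow_mem (hS : ∀ n, ∀ q ∈ S n, f n q ∈ S (n + 1)) {n : ℕ} {q : Q} (hq : q ∈ S n) (j : ℕ) :
    flow f n j q ∈ S (n + j) := by
  induction j with
  | zero => exact hq
  | succ j ih => exact hS _ _ ih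

/-- `T` loses the points that take a bad step, `B` collects the points of `S` outside `T` each time
it is empty and loses the points that have merged into `T`. -/
structure BreakpointEvolution (f : ℕ → Q → Q) (S : ℕ → Set Q) (bad : ℕ → Q → Prop)
    (T B : ℕ → Set Q) (N : ℕ) : Prop where
  target : ∀ n ≥ N, T (n + 1) = f n '' {q ∈ T n | ¬ bad n q}
  collect : ∀ n ≥ N, B n = ∅ → B (n + 1) = S (n + 1) \ T (n + 1)
  advance : ∀ n ≥ N, B n ≠ ∅ → B (n + 1) = f n '' B n \ T (n + 1)

/-- The cardinality of `T` never increases, so it stabilizes, and from then on no point of `T` takes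
a bad step. After a breakpoint `T ∪ B` contains the path `x`; at the next one `B` is empty, so `x`
lies in `T` and stays there. -/
lemma BreakpointEvolution.eventually_not_bad [Finite Q] {N : ℕ}
    (h : BreakpointEvolution f S bad T B N) (hB : ∃ᶠ n in atTop, B n = ∅) {x : ℕ → Q} {M : ℕ}
    (hxS : ∀ n ≥ M, x n ∈ S n) (hx : ∀ n ≥ M, x (n + 1) = f n (x n)) :
    ∀ᶠ n in atTop, ¬ bad n (x n) := by
  have card_le : ∀ n ≥ N, (T (n + 1)).ncard ≤ {q ∈ T n | ¬ bad n q}.ncard := fun n hn => by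
    rw [h.target n hn]; exact Set.ncard_image_le
  have sub : ∀ n, {q ∈ T n | ¬ bad n q} ⊆ T n := fun n => Set.sep_subset _ _
  have anti : Antitone fun j => (T (N + j)).ncard := antitone_nat_of_succ_le fun j =>
    (card_le (N + j) (by lia)).trans (Set.ncard_le_ncard (sub _))
  obtain ⟨J, hJ⟩ : ∃ J, ∀ j ≥ J, (T (N + j)).ncard = (T (N + J)).ncard := by
    obtain ⟨_, ⟨J, rfl⟩, hJ⟩ := wellFounded_lt.has_min (Set.range fun j => (T (N + j)).ncard) ⟨_, 0, rfl⟩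
    exact ⟨J, fun j hj => (anti hj).antisymm (not_lt.1 (hJ _ ⟨j, rfl⟩))⟩
  have nobad : ∀ n ≥ N + J, ∀ q ∈ T n, ¬ bad n q := by
    intro n hn
    obtain ⟨j, rfl⟩ := Nat.exists_eq_add_of_le (show N ≤ n by lia)
    have e : {q ∈ T (N + j) | ¬ bad (N + j) q} = T (N + j) := by
      refine Set.eq_of_subset_of_ncard_le (sub _) ?_
      have := card_le (N + j) (by lia)
      have h1 := hJ j (by lia)
      have h2 := hJ (j + 1) (by lia)
      rw [← add_assoc] at h2
      lia
    intro q hq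
    rw [← e] at hq
    exact hq.2
  have tstep : ∀ n ≥ N + J, ∀ q ∈ T n, f n q ∈ T (n + 1) := fun n hn q hq => by
    rw [h.target n (by lia)]; exact ⟨q, ⟨hq, nobad n hn q hq⟩, rfl⟩
  obtain ⟨n, hn, hBn⟩ := frequently_atTop.1 hB (max M (N + J))
  have cover : ∀ m ≥ n + 1, x m ∈ T m ∪ B m := by
    intro m hm
    induction m, hm using Nat.le_induction with
    | base =>
      by_cases ht : x (n + 1) ∈ T (n + 1)
      · exact Or.inl ht
      · right; rw [h.collect n (by lia) hBn]; exact ⟨hxS _ (by lia), ht⟩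
    | succ m hm ih =>
      by_cases ht : x (m + 1) ∈ T (m + 1)
      · exact Or.inl ht
      · right
        by_cases hb : B m = ∅
        · rw [h.collect m (by lia) hb]; exact ⟨hxS _ (by lia), ht⟩
        · rw [h.advance m (by lia) hb]
          refine ⟨?_, ht⟩
          rw [hx m (by lia)] at ht ⊢
          rcases ih with ih | ih
          · exact absurd (tstep m (by lia) _ ih) ht
          · exact ⟨_, ih, rfl⟩
  obtain ⟨m, hm, hBm⟩ := frequently_atTop.1 hB (n + 1)
  have stay : ∀ k ≥ m, x k ∈ T k := by
    intro k hk
    induction k, hk using Nat.le_induction with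
    | base => simpa [hBm] using cover m hm
    | succ k hk ih => rw [hx k (by lia)]; exact tstep k (by lia) _ ih
  filter_upwards [eventually_ge_atTop m] with k hk
  exact nobad k (by lia) _ (stay k hk)

/-- The maximum is over all starting times as well as all sets. Hence the images of `T` at later
times are still largest, and no further point can be added to them. -/
lemma exists_maximal_noncoalescing [Finite Q] (f : ℕ → Q → Q) (S : ℕ → Set Q) :
    ∃ n T, (T ⊆ S n ∧ ∀ j, Set.InjOn (flow f n j) T) ∧
      ∀ n' T', T' ⊆ S n' → (∀ j, Set.InjOn (flow f n' j) T') → T'.ncard ≤ T.ncard := by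
  let P : ℕ → Prop := fun k => ∃ n T, (T ⊆ S n ∧ ∀ j, Set.InjOn (flow f n j) T) ∧ T.ncard = k
  have hP : ∃ k, P k := ⟨0, 0, ∅, ⟨Set.empty_subset _, fun j => Set.injOn_empty _⟩, by simp⟩
  have hb : ∀ k, P k → k ≤ Nat.card Q := by
    rintro k ⟨n, T, -, rfl⟩
    rw [← Set.ncard_univ]; exact Set.ncard_le_ncard (Set.subset_univ _)
  classical
  obtain ⟨n, T, h, hT⟩ : P (Nat.findGreatest P (Nat.card Q)) :=
    Nat.findGreatest_spec (hb _ hP.choose_spec) hP.choose_spec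
  refine ⟨n, T, h, fun n' T' h1 h2 => ?_⟩
  rw [hT]
  exact Nat.le_findGreatest (hb _ ⟨n', T', ⟨h1, h2⟩, rfl⟩) ⟨n', T', ⟨h1, h2⟩, rfl⟩

/-- Let `T₁` be a largest set that never coalesces. Its finitely many paths are eventually free of
bad steps, so from then on `T` is the image of `T₁`. A point that never met `T` could be added to
it, against maximality; so all points of `S` at a given time merge into `T` within a common delay,
and `B` runs empty. -/
lemma exists_frequently_breakpoint [Finite Q] (hS : ∀ n, ∀ q ∈ S n, f n q ∈ S (n + 1))
    (hbad : ∀ n, ∀ q ∈ S n, ∀ᶠ j in atTop, ¬ bad (n + j) (flow f n j q)) :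
    ∃ N > 0, ∃ T₀, ∀ T B, T N = T₀ → B N = ∅ → BreakpointEvolution f S bad T B N →
      ∃ᶠ n in atTop, B n = ∅ := by
  obtain ⟨n₀, T₁, ⟨hT₁S, hT₁⟩, hmax⟩ := exists_maximal_noncoalescing f S
  have hall : ∀ᶠ j in atTop, ∀ q : T₁, ¬ bad (n₀ + j) (flow f n₀ j q) :=
    eventually_all.2 fun q => hbad n₀ q (hT₁S q.2)
  -- `J > 0` makes the starting time positive: the dual automaton needs one step to record its
  -- guess.
  obtain ⟨J, hJ'⟩ := eventually_atTop.1 (hall.and (eventually_gt_atTop 0))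
  have hJ := fun j hj => (hJ' j hj).1
  have hJ0 : 0 < J := (hJ' J le_rfl).2
  refine ⟨n₀ + J, by lia, flow f n₀ J '' T₁, fun T B hT hB h => ?_⟩
  have hTflow : ∀ j ≥ J, T (n₀ + j) = flow f n₀ j '' T₁ := by
    intro j hj
    induction j, hj using Nat.le_induction with
    | base => exact hT
    | succ j hj ih =>
      rw [← add_assoc, h.target _ (by lia), ih]
      have : {q ∈ flow f n₀ j '' T₁ | ¬ bad (n₀ + j) q} = flow f n₀ j '' T₁ := by
        refine Set.sep_eq_self_iff_mem_true.2 ?_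
        rintro _ ⟨q, hq, rfl⟩
        exact hJ j hj ⟨q, hq⟩
      rw [this, ← Set.image_comp]; rfl
  have hBS : ∀ n ≥ n₀ + J, B n ⊆ S n := by
    intro n hn
    induction n, hn using Nat.le_induction with
    | base => simp [hB]
    | succ n hn ih =>
      by_cases hb : B n = ∅
      · rw [h.collect n hn hb]; exact Set.sdiff_subset
      · rw [h.advance n hn hb]
        rintro _ ⟨⟨q, hq, rfl⟩, -⟩
        exact hS n q (ih hq)
  rw [frequently_atTop]
  intro M₀
  by_contra! hne
  set m := max M₀ J with hm
  have hne' : ∀ n ≥ n₀ + m, B n ≠ ∅ := fun n hn => (hne n (by lia)).ne_empty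
  have hmerge : ∀ q ∈ S (n₀ + m), ∃ j, flow f (n₀ + m) j q ∈ T (n₀ + m + j) := by
    intro q hq
    by_contra! hq'
    have e : ∀ i, flow f n₀ (m + i) '' T₁ = flow f (n₀ + m) i '' T (n₀ + m) := fun i => by
      rw [hTflow m (by lia), ← Set.image_comp]
      exact Set.image_congr fun q _ => flow_add _ _ _ _
    have hq0 : q ∉ T (n₀ + m) := hq' 0
    have := hmax (n₀ + m) (insert q (T (n₀ + m))) ?_ ?_
    · rw [Set.ncard_insert_of_notMem hq0, hTflow m (by lia), (hT₁ m).ncard_image] at this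
      lia
    · refine Set.insert_subset hq ?_
      rw [hTflow m (by lia)]
      rintro _ ⟨p, hp, rfl⟩
      exact flow_mem hS (hT₁S hp) m
    · intro j
      rw [Set.injOn_insert hq0]
      constructor
      · rw [hTflow m (by lia)]
        rintro _ ⟨p, hp, rfl⟩ _ ⟨p', hp', rfl⟩ hpp
        rw [← flow_add, ← flow_add] at hpp
        rw [hT₁ _ hp hp' hpp]
      · rw [← e j, ← hTflow (m + j) (by lia), ← add_assoc]
        exact hq' j
  have hstay : ∀ q ∈ S (n₀ + m), ∀ᶠ j in atTop, flow f (n₀ + m) j q ∈ T (n₀ + m + j) := by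
    intro q hq
    obtain ⟨j, hj⟩ := hmerge q hq
    filter_upwards [eventually_ge_atTop j] with i hi
    obtain ⟨k, rfl⟩ := Nat.exists_eq_add_of_le hi
    rw [add_assoc, hTflow (m + j) (by lia)] at hj
    obtain ⟨p, hp, hpq⟩ := hj
    rw [add_assoc, hTflow _ (by lia), flow_add, ← hpq]
    refine ⟨p, hp, ?_⟩
    rw [← add_assoc, flow_add, add_assoc]
  obtain ⟨j, hj, hj0⟩ := ((eventually_all (ι := S (n₀ + m)).2 fun q => hstay q q.2).and
    (eventually_gt_atTop 0)).exists
  have himg : ∀ i, B (n₀ + m + i) ⊆ flow f (n₀ + m) i '' B (n₀ + m) := by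
    intro i
    induction i with
    | zero => simp [flow]
    | succ i ih =>
      rw [← add_assoc, h.advance _ (by lia) (hne' _ (by lia))]
      rintro _ ⟨⟨q, hq, rfl⟩, -⟩
      obtain ⟨p, hp, rfl⟩ := ih hq
      exact ⟨p, hp, rfl⟩
  obtain ⟨q, hq⟩ := Set.nonempty_iff_ne_empty.2 (hne' (n₀ + m + j) (by lia))
  -- Since `j > 0`, this `B` results from an `advance` step, which removes `T`.
  have hqT : q ∉ T (n₀ + m + j) := by
    obtain ⟨i, rfl⟩ := Nat.exists_eq_add_of_lt hj0
    have e : n₀ + m + (0 + i + 1) = n₀ + m + i + 1 := by ring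
    rw [e] at hq ⊢
    rw [h.advance _ (by lia) (hne' _ (by lia))] at hq
    exact hq.2
  obtain ⟨p, hp, rfl⟩ := himg j hq
  exact hqT (hj ⟨p, hBS _ (by lia) hp⟩)

end CoalescingFlow

/-! ### A Baire category obstruction. -/

/-- The set of words with infinitely many `true` is not an `F_σ`. -/
lemma infinitely_many_true_ne_iUnion_isClosed (C : ℕ → Set (ℕ → Bool)) (hC : ∀ n, IsClosed (C n)) :
    {w : ℕ → Bool | ∃ᶠ n in atTop, w n = true} ≠ ⋃ n, C n := by
  intro h
  -- Any word is a limit of words that are eventually `b`. Both values of `b` are needed: `true`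
  -- makes the first family of open sets dense, `false` the complements of the `C m`.
  have key : ∀ b : Bool, ∀ P : Set (ℕ → Bool),
      (∀ w : ℕ → Bool, (∀ᶠ n in atTop, w n = b) → w ∈ P) → Dense P := by
    intro b P hP w
    rw [mem_closure_iff_seq_limit]
    refine ⟨fun k n => if n < k then w n else b, fun k => hP _ ?_, ?_⟩
    · filter_upwards [eventually_ge_atTop k] with n hn
      simp [hn]
    · rw [tendsto_pi_nhds]
      intro n
      refine tendsto_const_nhds.congr' ?_
      filter_upwards [eventually_gt_atTop n] with k hk
      simp [hk]
  let U : ℕ ⊕ ℕ → Set (ℕ → Bool) := Sum.elim (fun N => {w | ∃ n ≥ N, w n = true}) fun m => (C m)ᶜ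
  have hopen : ∀ i, IsOpen (U i) := by
    rintro (N | m)
    · have : {w : ℕ → Bool | ∃ n ≥ N, w n = true} = ⋃ n ≥ N, (fun w => w n) ⁻¹' {true} := by
        ext; simp
      simp only [U, Sum.elim_inl, this]
      exact isOpen_biUnion fun n _ => (isOpen_discrete _).preimage (continuous_apply n)
    · exact (hC m).isOpen_compl
  have hdense : ∀ i, Dense (U i) := by
    rintro (N | m)
    · exact key true _ fun w hw => frequently_atTop.1 hw.frequently N
    · refine key false _ fun w hw hwC => ?_
      have : w ∈ {w : ℕ → Bool | ∃ᶠ n in atTop, w n = true} := h ▸ Set.mem_iUnion.2 ⟨m, hwC⟩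
      obtain ⟨n, h1, h2⟩ := (Frequently.and_eventually this hw).exists
      simp_all
  obtain ⟨w, hw⟩ := (dense_iInter_of_isOpen hopen hdense).nonempty
  rw [Set.mem_iInter] at hw
  have : w ∈ ⋃ n, C n := h ▸ frequently_atTop.2 fun N => hw (.inl N)
  obtain ⟨m, hm⟩ := Set.mem_iUnion.1 this
  exact hw (.inr m) hm

/-! ### Independent noise: shifts, prefixes and the zero-one law. -/

section IID

variable {X : Type*} [MeasurableSpace X] (μ : Measure X) [IsProbabilityMeasure μ]

/-- The law of a sequence of independent random variables with law `μ`. -/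
noncomputable abbrev iid : Measure (ℕ → X) := Measure.infinitePi fun _ : ℕ => μ

/-- The sequence without its first `n` terms. -/
def suffix {β : Type*} (n : ℕ) (w : ℕ → β) : ℕ → β := fun i => w (n + i)

lemma suffix_suffix {β : Type*} (m n : ℕ) (w : ℕ → β) : suffix n (suffix m w) = suffix (m + n) w := by
  ext i; simp [suffix, add_assoc]

lemma measurable_suffix (n : ℕ) : Measurable (suffix n : (ℕ → X) → ℕ → X) := by
  unfold suffix; fun_prop

lemma iid_preimage_suffix (n : ℕ) {H : Set (ℕ → X)} (hH : MeasurableSet H) :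
    iid μ (suffix n ⁻¹' H) = iid μ H := by
  have h := Measure.map_infinitePi_infinitePi_of_inj (P := fun _ : ℕ => μ) (add_right_injective n)
  rw [← Measure.map_apply (measurable_suffix n) hH]
  exact congrArg (fun m => m H) h

/-- The σ-algebra generated by the `i`-th coordinate. -/
abbrev coordAlgebra (X : Type*) [MeasurableSpace X] (i : ℕ) : MeasurableSpace (ℕ → X) :=
  MeasurableSpace.comap (fun ω => ω i) inferInstance

lemma coordAlgebra_le (i : ℕ) : coordAlgebra X i ≤ MeasurableSpace.pi :=
  (measurable_pi_apply i).comap_le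

lemma iIndep_coordAlgebra : iIndep (coordAlgebra X) (iid μ) :=
  iIndepFun_infinitePi (X := fun _ x => x) fun _ => measurable_id

lemma measurableSet_preimage_suffix {m n : ℕ} (hmn : m ≤ n) {H : Set (ℕ → X)}
    (hH : MeasurableSet H) :
    MeasurableSet[⨆ i ∈ Set.Ici m, coordAlgebra X i] (suffix n ⁻¹' H) := by
  have : Measurable[⨆ i ∈ Set.Ici m, coordAlgebra X i] (suffix n : (ℕ → X) → ℕ → X) := by
    refine @measurable_pi_lambda _ _ _ (_) _ _ fun i => ?_
    refine Measurable.mono (comap_measurable (fun ω : ℕ → X => ω (n + i))) ?_ le_rfl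
    exact le_biSup (coordAlgebra X) (show n + i ∈ Set.Ici m from le_add_right hmn)
  exact this hH

/-- The first `n` coordinates are independent of the rest. With `n = 1` this carries null events to
successor states; with larger `n` it prescribes the guesses made before a suffix event. -/
lemma iid_pi_inter_preimage_suffix (n : ℕ) {t : ℕ → Set X} (ht : ∀ i, MeasurableSet (t i))
    {H : Set (ℕ → X)} (hH : MeasurableSet H) :
    iid μ (Set.pi (Finset.range n) t ∩ suffix n ⁻¹' H) =
      (∏ i ∈ Finset.range n, μ (t i)) * iid μ H := by
  have hI : Indep (⨆ i ∈ Set.Iio n, coordAlgebra X i) (⨆ i ∈ Set.Ici n, coordAlgebra X i) (iid μ) :=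
    indep_iSup_of_disjoint coordAlgebra_le (iIndep_coordAlgebra μ)
      (Set.disjoint_left.2 fun i (h : i < n) (h' : n ≤ i) => by lia)
  rw [Indep_iff] at hI
  rw [hI _ _ ?_ (measurableSet_preimage_suffix le_rfl hH), iid_preimage_suffix μ n hH,
    Measure.infinitePi_pi _ fun i _ => ht i]
  have e : Set.pi (Finset.range n) t = ⋂ i ∈ Set.Iio n, (fun ω : ℕ → X => ω i) ⁻¹' t i := by
    ext; simp
  rw [e]
  refine .biInter (Set.to_countable _) fun i hi => ?_
  exact le_biSup (coordAlgebra X) hi _ ⟨t i, ht i, rfl⟩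

lemma iid_tail_zero_or_one {E : Set (ℕ → X)}
    (hE : ∀ n, MeasurableSet[⨆ i ∈ Set.Ici n, coordAlgebra X i] E) :
    iid μ E = 0 ∨ iid μ E = 1 := by
  refine measure_zero_or_one_of_measurableSet_limsup_atTop coordAlgebra_le (iIndep_coordAlgebra μ) ?_
  rw [limsup_eq_iInf_iSup_of_nat, MeasurableSpace.measurableSet_iInf]
  exact hE

end IID

/-! ### Runs as sequences driven by noise. -/

section Drive

variable {Q X α : Type*}

/-- The sequence of states that starts at `q` and follows the update function `g` along the word `w`
and the noise `ω`. -/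
def drive (g : Q → α → X → Q) (w : ℕ → α) (q : Q) (ω : ℕ → X) : ℕ → Q
  | 0 => q
  | n + 1 => g (drive g w q ω n) (w n) (ω n)

variable {g : Q → α → X → Q}

lemma drive_add (w : ℕ → α) (q : Q) (ω : ℕ → X) (n i : ℕ) :
    drive g w q ω (n + i) = drive g (suffix n w) (drive g w q ω n) (suffix n ω) i := by
  induction i with
  | zero => rfl
  | succ i ih =>
    rw [← add_assoc]
    change g (drive g w q ω (n + i)) _ _ = g _ _ _
    rw [ih]; rfl

lemma drive_congr {w w' : ℕ → α} (q : Q) (ω : ℕ → X) {n : ℕ} (h : ∀ i < n, w i = w' i) :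
    drive g w q ω n = drive g w' q ω n := by
  induction n with
  | zero => rfl
  | succ n ih =>
    change g (drive g w q ω n) _ _ = g _ _ _
    rw [ih fun i hi => h i (by lia), h n (by lia)]

variable [Finite Q] [MeasurableSpace Q] [DiscreteMeasurableSpace Q]
  [Finite X] [MeasurableSpace X] [DiscreteMeasurableSpace X]

lemma measurable_drive (w : ℕ → α) :
    Measurable fun p : Q × (ℕ → X) => drive g w p.1 p.2 := by
  refine measurable_pi_lambda _ fun n => ?_
  induction n with
  | zero => exact measurable_fst
  | succ n ih =>
    have h : Measurable fun p : Q × X => g p.1 (w n) p.2 := measurable_of_finite _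
    exact h.comp (ih.prodMk ((measurable_pi_apply n).comp measurable_snd))

lemma measurable_drive_right (w : ℕ → α) (q : Q) : Measurable fun ω : ℕ → X => drive g w q ω :=
  (measurable_drive w).comp measurable_prodMk_left

end Drive

/-- A probability measure on sequences in a finite space is determined by the prefix cylinders. -/
lemma measure_ext_of_cylinder {Q : Type*} [Finite Q] [MeasurableSpace Q] [DiscreteMeasurableSpace Q]
    {μ ν : Measure (ℕ → Q)} [IsProbabilityMeasure μ] [IsProbabilityMeasure ν]
    (h : ∀ (q : ℕ → Q) k, μ {r | ∀ i ≤ k, r i = q i} = ν {r | ∀ i ≤ k, r i = q i}) : μ = ν := by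
  have key : ∀ n, μ.map (Preorder.frestrictLe n) = ν.map (Preorder.frestrictLe n) := by
    intro n
    refine Measure.ext_of_singleton fun x => ?_
    -- Only a filler for the indices beyond `n`, which the cylinder does not constrain.
    have ⟨r₀⟩ := nonempty_of_isProbabilityMeasure μ
    have e : Preorder.frestrictLe (π := fun _ => Q) n ⁻¹' {x} =
        {r | ∀ i ≤ n, r i = if hi : i ≤ n then x ⟨i, Finset.mem_Iic.2 hi⟩ else r₀ i} := by
      ext r
      simp only [Set.mem_preimage, Set.mem_singleton_iff, funext_iff, Subtype.forall, Finset.mem_Iic,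
        Set.mem_ofPred_eq]
      refine forall₂_congr fun i hi => ?_
      rw [dif_pos hi]; rfl
    rw [Measure.map_apply (by fun_prop) (measurableSet_singleton _),
      Measure.map_apply (by fun_prop) (measurableSet_singleton _), e, h]
  have hμ : IsProjectiveLimit μ fun I => ν.map I.restrict := by
    intro I
    have hI := I.subset_Iic_sup_id
    have h1 : I.restrict (π := fun _ => Q) =
      Finset.restrict₂ hI ∘ Preorder.frestrictLe (I.sup id) := rfl
    change μ.map (I.restrict (π := fun _ => Q)) = ν.map (I.restrict (π := fun _ => Q))
    rw [h1, ← Measure.map_map (by fun_prop) (by fun_prop), key,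
      Measure.map_map (by fun_prop) (by fun_prop)]
  have : ∀ I : Finset ℕ, IsFiniteMeasure (ν.map (I.restrict (π := fun _ => Q))) :=
    fun I => inferInstance
  exact hμ.unique fun I => rfl

namespace ProbWeightedAutomaton

variable {α : Type} (A : ProbWeightedAutomaton α) (w : ℕ → α)
  {X : Type*} [MeasurableSpace X] {μ : Measure X} [IsProbabilityMeasure μ] {g : A.Q → α → X → A.Q}

/-- Moves of probability zero give countably many null events, so one null set of noise serves all
states and times, hence every path of the flow. -/
lemma ae_trans_pos (hg : ∀ q a q', μ {x | g q a x = q'} = A.trans q a q') :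
    ∀ᵐ ω ∂iid μ, ∀ n q, 0 < A.trans q (w n) (g q (w n) (ω n)) := by
  rw [ae_all_iff]; intro n
  rw [ae_all_iff]; intro q
  have h : ∀ᵐ x ∂μ, 0 < A.trans q (w n) (g q (w n) x) := by
    have h' : ∀ q', ∀ᵐ x ∂μ, g q (w n) x = q' → 0 < A.trans q (w n) q' := by
      intro q'
      by_cases h0 : 0 < A.trans q (w n) q'
      · exact Eventually.of_forall fun _ _ => h0
      · rw [ae_iff]
        simp only [h0, Classical.not_imp, not_false_eq_true, and_true]
        rw [hg]; simpa using h0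
    filter_upwards [ae_all_iff.2 h'] with x hx using hx _ rfl
  have e := Measure.infinitePi_map_eval (fun _ : ℕ => μ) n
  rw [← e] at h
  exact ae_of_ae_map (measurable_pi_apply n).aemeasurable h

variable [Finite X] [DiscreteMeasurableSpace X]

/-- A prefix cylinder pulls back to a rectangle, one condition for each noise coordinate. Only the
marginals of `g` enter, so the moves of different states may be coupled arbitrarily. -/
theorem runMeasure_eq_map (hg : ∀ q a q', μ {x | g q a x = q'} = A.trans q a q') :
    A.runMeasure w =
      (A.init.toMeasure.prod (iid μ)).map fun p => drive g w p.1 p.2 := by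
  have : IsProbabilityMeasure A.init.toMeasure := PMF.toMeasure.isProbabilityMeasure _
  have := Measure.isProbabilityMeasure_map (μ := A.init.toMeasure.prod (iid μ))
    (measurable_drive (g := g) w).aemeasurable
  refine measure_ext_of_cylinder fun q k => ?_
  rw [runMeasure_cylinder, Measure.map_apply (measurable_drive w) ?_]
  · have e : (fun p : A.Q × (ℕ → X) => drive g w p.1 p.2) ⁻¹' {r | ∀ i ≤ k, r i = q i} =
        {q 0} ×ˢ Set.pi (Finset.range k) fun i => {x | g (q i) (w i) x = q (i + 1)} := by
      ext ⟨q₀, ω⟩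
      simp only [Set.mem_preimage, Set.mem_ofPred_eq, Set.mem_prod, Set.mem_singleton_iff, Set.mem_pi,
        Finset.coe_range, Set.mem_Iio]
      constructor
      · intro h
        refine ⟨h 0 (by lia), fun i hi => ?_⟩
        rw [← h i (by lia), ← h (i + 1) (by lia)]; rfl
      · rintro ⟨h0, h⟩ i hi
        induction i with
        | zero => exact h0
        | succ i ih =>
          change g (drive g w q₀ ω i) _ _ = _
          rw [ih (by lia)]; exact h i (by lia)
    rw [e, Measure.prod_prod, PMF.toMeasure_apply_singleton _ _ (measurableSet_singleton _),
      Measure.infinitePi_pi _ fun _ _ => .of_discrete]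
    simp_rw [hg]
  · have : {r : ℕ → A.Q | ∀ i ≤ k, r i = q i} = ⋂ i ≤ k, (fun r => r i) ⁻¹' {q i} := by ext; simp
    rw [this]
    exact .biInter (Set.to_countable _) fun i _ => measurable_pi_apply i (measurableSet_singleton _)

lemma runMeasure_eq_zero_iff (hg : ∀ q a q', μ {x | g q a x = q'} = A.trans q a q')
    {S : Set (ℕ → A.Q)} (hS : MeasurableSet S) :
    A.runMeasure w S = 0 ↔ ∀ q, 0 < A.init q → iid μ {ω | drive g w q ω ∈ S} = 0 := by
  have : IsProbabilityMeasure A.init.toMeasure := PMF.toMeasure.isProbabilityMeasure _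
  rw [A.runMeasure_eq_map w hg, Measure.map_apply (measurable_drive w) hS,
    Measure.measure_prod_null (measurable_drive w hS), EventuallyEq, ae_iff,
    PMF.toMeasure_apply_eq_zero_iff _ .of_discrete, Set.disjoint_left]
  refine forall_congr' fun q => ?_
  rw [PMF.mem_support_iff, pos_iff_ne_zero]
  simp [Set.preimage]

lemma measurableSet_isRun : MeasurableSet {r | A.IsRun w r} := by
  have : {r | A.IsRun w r} = (fun r => r 0) ⁻¹' {q | 0 < A.init q} ∩
      ⋂ n, (fun r => (r n, r (n + 1))) ⁻¹' {p | 0 < A.trans p.1 (w n) p.2} := by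
    ext; simp [IsRun]
  rw [this]
  refine (measurable_pi_apply 0 .of_discrete).inter (.iInter fun n => ?_)
  exact ((measurable_pi_apply n).prodMk (measurable_pi_apply (n + 1))) .of_discrete

/-- The law of independent moves of all pairs of a letter and a state. -/
noncomputable def moveLaw : Measure (α × A.Q → A.Q) :=
  Measure.infinitePi fun p : α × A.Q => (A.trans p.2 p.1).toMeasure

instance : IsProbabilityMeasure A.moveLaw := by
  have : ∀ p : α × A.Q, IsProbabilityMeasure (A.trans p.2 p.1).toMeasure :=
    fun _ => PMF.toMeasure.isProbabilityMeasure _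
  unfold moveLaw; infer_instance

lemma moveLaw_apply (q : A.Q) (a : α) (q' : A.Q) :
    A.moveLaw {u | u (a, q) = q'} = A.trans q a q' := by
  have : ∀ p : α × A.Q, IsProbabilityMeasure (A.trans p.2 p.1).toMeasure :=
    fun _ => PMF.toMeasure.isProbabilityMeasure _
  have h := Measure.infinitePi_map_eval (fun p : α × A.Q => (A.trans p.2 p.1).toMeasure) (a, q)
  have h2 := congrArg (fun m => m {q'}) h
  rw [Measure.map_apply (measurable_pi_apply _) (measurableSet_singleton _),
    PMF.toMeasure_apply_singleton _ _ (measurableSet_singleton _)] at h2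
  exact h2

lemma ae_isRun [Finite α] : ∀ᵐ r ∂A.runMeasure w, A.IsRun w r := by
  rw [ae_iff]
  refine (A.runMeasure_eq_zero_iff w A.moveLaw_apply (A.measurableSet_isRun w).compl).2
    fun q hq => ?_
  have h := A.ae_trans_pos w A.moveLaw_apply
  rw [ae_iff] at h
  refine measure_mono_null (fun ω hω => ?_) h
  exact fun hpos => hω ⟨hq, fun n => hpos n _⟩

end ProbWeightedAutomaton

/-! ### Duality of the semantics, and the `F_σ` property. -/

lemma measurableSet_frequently {Ω : Type*} {m : MeasurableSpace Ω} {s : ℕ → Set Ω}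
    (hs : ∀ n, MeasurableSet (s n)) : MeasurableSet {x | ∃ᶠ n in atTop, x ∈ s n} := by
  have : {x | ∃ᶠ n in atTop, x ∈ s n} = ⋂ N, ⋃ n, ⋃ (_ : N ≤ n), s n := by
    ext; simp [frequently_atTop]
  rw [this]
  exact .iInter fun N => .iUnion fun n => .iUnion fun _ => hs n

/-- Let `s` be the left-hand supremum. It need not be attained, but a countable union gives `X ≤ s`
almost surely, so `-s` is attained on the right. Boundedness rules out the default values of `sSup`.
-/
lemma sSup_pos_eq_neg_sSup_ae {Ω : Type*} [MeasurableSpace Ω] {P : Measure Ω} [IsProbabilityMeasure P]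
    {X : Ω → ℝ} (hX : Measurable X) {C : ℝ} (hC : ∀ ω, |X ω| ≤ C) :
    sSup {η | 0 < P {ω | η ≤ X ω}} = -sSup {η | P {ω | η ≤ -X ω} = 1} := by
  set D := {η | 0 < P {ω | η ≤ X ω}}
  have hne : -C ∈ D := by
    have : {ω | -C ≤ X ω} = Set.univ := Set.eq_univ_of_forall fun ω => (abs_le.1 (hC ω)).1
    simp [D, this]
  have hbdd : BddAbove D := by
    refine ⟨C, fun η hη => ?_⟩
    obtain ⟨ω, hω⟩ := nonempty_of_measure_ne_zero (ne_of_gt hη)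
    exact le_trans hω (abs_le.1 (hC ω)).2
  refine (neg_eq_iff_eq_neg.1 ?_)
  refine (IsGreatest.csSup_eq ⟨?_, ?_⟩).symm
  · have h0 : P {ω | sSup D < X ω} = 0 := by
      have : {ω | sSup D < X ω} = ⋃ n : ℕ, {ω | sSup D + 1 / (n + 1 : ℝ) ≤ X ω} := by
        ext ω
        simp only [Set.mem_ofPred_eq, Set.mem_iUnion]
        constructor
        · intro h
          obtain ⟨n, hn⟩ := exists_nat_one_div_lt (sub_pos.2 h)
          exact ⟨n, by linarith⟩
        · rintro ⟨n, hn⟩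
          have : (0 : ℝ) < 1 / (n + 1) := by positivity
          linarith
      rw [this, measure_iUnion_null_iff]
      intro n
      by_contra hn
      have h1 := le_csSup hbdd (show sSup D + 1 / (n + 1 : ℝ) ∈ D from pos_iff_ne_zero.2 hn)
      have : (0 : ℝ) < 1 / (n + 1) := by positivity
      linarith
    have h1 : {ω | -sSup D ≤ -X ω} = {ω | sSup D < X ω}ᶜ := by ext; simp
    change P _ = 1
    rw [h1, prob_compl_eq_one_iff (measurableSet_lt measurable_const hX), h0]
  · intro η hη
    by_contra! hlt
    obtain ⟨η', hη', hlt'⟩ := exists_lt_of_lt_csSup ⟨_, hne⟩ (show -η < sSup D by linarith)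
    have hm : MeasurableSet {ω | η ≤ -X ω} := measurableSet_le measurable_const hX.neg
    have h0 := (prob_compl_eq_zero_iff hm).2 hη
    refine (ne_of_gt hη') (measure_mono_null (fun ω (hω : η' ≤ X ω) => ?_) h0)
    simp only [Set.mem_compl_iff, Set.mem_ofPred_eq, not_le]
    linarith

namespace ProbWeightedAutomaton

variable {α : Type} (A : ProbWeightedAutomaton α) (w : ℕ → α)

lemma measurableSet_weights (P : ℚ → Prop) (n : ℕ) :
    MeasurableSet {r : ℕ → A.Q | P (A.weights w r n)} := by
  have h : Measurable fun r : ℕ → A.Q => (r n, r (n + 1)) := by fun_prop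
  exact h (.of_discrete : MeasurableSet {p : A.Q × A.Q | P (A.weight p.1 (w n) p.2)})

lemma measurableSet_frequently_weights (P : ℚ → Prop) :
    MeasurableSet {r : ℕ → A.Q | ∃ᶠ n in atTop, P (A.weights w r n)} :=
  measurableSet_frequently fun n => A.measurableSet_weights w P n

/-- The automaton with all weights negated. -/
def neg : ProbWeightedAutomaton α where
  Q := A.Q
  finite_Q := A.finite_Q
  init := A.init
  trans := A.trans
  weight q a q' := -A.weight q a q'

lemma neg_neg : A.neg.neg = A := by
  cases A; simp [neg]

variable [Finite α]

lemma finite_range_weights (r : ℕ → A.Q) : (Set.range (A.weights w r)).Finite := by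
  refine (Set.finite_range fun p : A.Q × α × A.Q => A.weight p.1 p.2.1 p.2.2).subset ?_
  rintro _ ⟨n, rfl⟩
  exact ⟨(r n, w n, r (n + 1)), rfl⟩

lemma exists_abs_weight_le : ∃ C : ℝ, ∀ q a q', |(A.weight q a q' : ℝ)| ≤ C := by
  obtain ⟨C, hC⟩ := (Set.finite_range fun p : A.Q × α × A.Q =>
    |(A.weight p.1 p.2.1 p.2.2 : ℝ)|).bddAbove
  exact ⟨C, fun q a q' => hC ⟨(q, a, q'), rfl⟩⟩

lemma measurable_LimSup_weights : Measurable fun r => LimSup (A.weights w r) := by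
  refine measurable_of_Ici fun η => ?_
  have : (fun r => LimSup (A.weights w r)) ⁻¹' Set.Ici η =
      {r | ∃ᶠ n in atTop, η ≤ A.weights w r n} := by
    ext r; exact le_LimSup_iff (A.finite_range_weights w r) η
  rw [this]
  exact A.measurableSet_frequently_weights w fun x => η ≤ x

lemma measurable_LimInf_weights : Measurable fun r => LimInf (A.weights w r) := by
  refine measurable_of_Iio fun η => ?_
  have : (fun r => LimInf (A.weights w r)) ⁻¹' Set.Iio η =
      {r | ∃ᶠ n in atTop, ¬ η ≤ (A.weights w r n : ℝ)} := by
    ext r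
    simp only [Set.mem_preimage, Set.mem_Iio, Set.mem_ofPred_eq]
    rw [← not_le, le_LimInf_iff (A.finite_range_weights w r) η, not_eventually]
  rw [this]
  exact A.measurableSet_frequently_weights w fun x => ¬ η ≤ (x : ℝ)

lemma exists_abs_LimSup_le : ∃ C, ∀ r, |LimSup (A.weights w r)| ≤ C := by
  obtain ⟨C, hC⟩ := A.exists_abs_weight_le
  refine ⟨C, fun r => abs_le.2 ⟨?_, ?_⟩⟩
  · rw [le_LimSup_iff (A.finite_range_weights w r)]
    exact Frequently.of_forall fun n => (abs_le.1 (hC _ _ _)).1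
  · rw [← not_lt, lt_LimSup_iff (A.finite_range_weights w r), not_frequently]
    exact Eventually.of_forall fun n => not_lt.2 (abs_le.1 (hC _ _ _)).2

lemma exists_abs_LimInf_le : ∃ C, ∀ r, |LimInf (A.weights w r)| ≤ C := by
  obtain ⟨C, hC⟩ := A.exists_abs_weight_le
  refine ⟨C, fun r => abs_le.2 ⟨?_, ?_⟩⟩
  · rw [le_LimInf_iff (A.finite_range_weights w r)]
    exact Eventually.of_forall fun n => (abs_le.1 (hC _ _ _)).1
  · rw [← not_lt, lt_LimInf_iff (A.finite_range_weights w r), not_eventually]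
    exact Frequently.of_forall fun n => not_lt.2 (abs_le.1 (hC _ _ _)).2

lemma positiveLang_eq (Val : (ℕ → ℚ) → ℝ) :
    A.positiveLang Val w = sSup {η : ℝ | 0 < A.runMeasure w {r | η ≤ Val (A.weights w r)}} := by
  unfold positiveLang
  congr 1; ext η
  have : A.runMeasure w {r | A.IsRun w r ∧ η ≤ Val (A.weights w r)} =
      A.runMeasure w {r | η ≤ Val (A.weights w r)} := by
    refine measure_congr ?_
    filter_upwards [A.ae_isRun w] with r hr
    exact propext ⟨And.right, And.intro hr⟩
  simp only [Set.mem_ofPred_eq, this]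

lemma almostSureLang_eq (Val : (ℕ → ℚ) → ℝ) :
    A.almostSureLang Val w = sSup {η : ℝ | A.runMeasure w {r | η ≤ Val (A.weights w r)} = 1} := by
  unfold almostSureLang
  congr 1; ext η
  have : A.runMeasure w {r | A.IsRun w r ∧ η ≤ Val (A.weights w r)} =
      A.runMeasure w {r | η ≤ Val (A.weights w r)} := by
    refine measure_congr ?_
    filter_upwards [A.ae_isRun w] with r hr
    exact propext ⟨And.right, And.intro hr⟩
  simp only [Set.mem_ofPred_eq, this]

lemma positiveLang_LimSup : A.positiveLang LimSup w = -A.neg.almostSureLang LimInf w := by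
  obtain ⟨C, hC⟩ := A.exists_abs_LimSup_le w
  have h : ∀ r : ℕ → A.Q, LimInf (A.neg.weights w r) = -LimSup (A.weights w r) :=
    fun r => LimInf_neg (A.finite_range_weights w r)
  rw [positiveLang_eq, almostSureLang_eq,
    sSup_pos_eq_neg_sSup_ae (A.measurable_LimSup_weights w) hC]
  simp_rw [← h]; rfl

lemma positiveLang_LimInf : A.positiveLang LimInf w = -A.neg.almostSureLang LimSup w := by
  obtain ⟨C, hC⟩ := A.exists_abs_LimInf_le w
  have h : ∀ r : ℕ → A.Q, LimSup (A.neg.weights w r) = -LimInf (A.weights w r) :=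
    fun r => LimSup_neg (A.finite_range_weights w r)
  rw [positiveLang_eq, almostSureLang_eq,
    sSup_pos_eq_neg_sSup_ae (A.measurable_LimInf_weights w) hC]
  simp_rw [← h]; rfl

/-- The limit exceeds `θ` when all weights after some `N` do, and a countable union has positive
measure when some member has. The bound `k` cuts the event into conditions on finite prefixes. -/
lemma lt_positiveLang_LimInf_iff (θ : ℝ) : θ < A.positiveLang LimInf w ↔
    ∃ N, 0 < A.runMeasure w {r | ∀ k, ∀ n < k, N ≤ n → θ < A.weights w r n} := by
  obtain ⟨C, hC⟩ := A.exists_abs_LimInf_le w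
  have hiff : θ < A.positiveLang LimInf w ↔ 0 < A.runMeasure w {r | θ < LimInf (A.weights w r)} := by
    rw [positiveLang_eq]
    constructor
    · intro h
      have hne : {η : ℝ | 0 < A.runMeasure w {r | η ≤ LimInf (A.weights w r)}}.Nonempty := by
        refine ⟨-C, ?_⟩
        have : {r | -C ≤ LimInf (A.weights w r)} = Set.univ :=
          Set.eq_univ_of_forall fun r => (abs_le.1 (hC r)).1
        simp [this]
      obtain ⟨η, hη, hlt⟩ := exists_lt_of_lt_csSup hne h
      exact lt_of_lt_of_le hη (measure_mono fun r hr => lt_of_lt_of_le hlt hr)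
    · intro h
      obtain ⟨b, hb, hgap⟩ := exists_gap_above
        (Set.finite_range fun p : A.Q × α × A.Q => (A.weight p.1 p.2.1 p.2.2 : ℝ)) θ
      refine hb.trans_le (le_csSup ⟨C, fun η hη => ?_⟩ (h.trans_le (measure_mono fun r hr => ?_)))
      · obtain ⟨r, hr⟩ := nonempty_of_measure_ne_zero (ne_of_gt hη)
        exact le_trans hr (abs_le.1 (hC r)).2
      · rw [Set.mem_ofPred_eq, lt_LimInf_iff (A.finite_range_weights w r)] at hr
        rw [Set.mem_ofPred_eq, le_LimInf_iff (A.finite_range_weights w r)]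
        filter_upwards [hr] with n hn using hgap _ ⟨(r n, w n, r (n + 1)), rfl⟩ hn
  have hU : {r | θ < LimInf (A.weights w r)} =
      ⋃ N, {r : ℕ → A.Q | ∀ k, ∀ n < k, N ≤ n → θ < A.weights w r n} := by
    ext r
    simp only [Set.mem_ofPred_eq, lt_LimInf_iff (A.finite_range_weights w r), eventually_atTop,
      Set.mem_iUnion]
    exact exists_congr fun N => ⟨fun h k n _ hn => h n hn, fun h n hn => h (n + 1) n (by lia) hn⟩
  rw [hiff, hU]
  constructor
  · exact fun h => exists_measure_pos_of_not_measure_iUnion_null (ne_of_gt h)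
  · rintro ⟨N, hN⟩
    exact hN.trans_le (measure_mono (Set.subset_iUnion_of_subset N subset_rfl))

/-- The event depends on the first `k` weights, so its probability depends on the first `k` letters,
and the set is pulled back from a finite discrete space. -/
lemma isClosed_le_runMeasure [TopologicalSpace α] [DiscreteTopology α] (c : ℝ≥0∞) (k : ℕ)
    (D : (ℕ → ℚ) → Prop) (hmeas : ∀ w, MeasurableSet {r : ℕ → A.Q | D (A.weights w r)})
    (hD : ∀ v v', (∀ n < k, v n = v' n) → D v → D v') :
    IsClosed {w | c ≤ A.runMeasure w {r | D (A.weights w r)}} := by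
  have hcongr : ∀ w w' : ℕ → α, (∀ n < k, w n = w' n) →
      A.runMeasure w {r | D (A.weights w r)} = A.runMeasure w' {r | D (A.weights w' r)} := by
    intro w w' h
    rw [A.runMeasure_eq_map w A.moveLaw_apply, A.runMeasure_eq_map w' A.moveLaw_apply,
      Measure.map_apply (measurable_drive w) (hmeas w),
      Measure.map_apply (measurable_drive w') (hmeas w')]
    congr 1
    ext ⟨q, ω⟩
    have hv : ∀ n < k, A.weights w (drive (fun q a u => u (a, q)) w q ω) n =
        A.weights w' (drive (fun q a u => u (a, q)) w' q ω) n := by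
      intro n hn
      simp only [weights]
      rw [drive_congr q ω (fun i hi => h i (by lia)), drive_congr q ω (fun i hi => h i (by lia)),
        h n hn]
    exact ⟨hD _ _ hv, hD _ _ fun n hn => (hv n hn).symm⟩
  let φ : (ℕ → α) → Fin k → α := fun w n => w n
  have hφ : Continuous φ := by fun_prop
  have e : {w | c ≤ A.runMeasure w {r | D (A.weights w r)}} =
      φ ⁻¹' (φ '' {w | c ≤ A.runMeasure w {r | D (A.weights w r)}}) := by
    refine (Set.subset_preimage_image _ _).antisymm ?_
    rintro w ⟨w', hw', hww'⟩
    rw [Set.mem_ofPred_eq] at hw' ⊢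
    rwa [hcongr w w' fun n hn => (congrFun hww' ⟨n, hn⟩).symm]
  rw [e]
  exact (isClosed_discrete _).preimage hφ

/-- The words whose value exceeds a threshold form an `F_σ`. -/
lemma exists_isClosed_iUnion_eq [TopologicalSpace α] [DiscreteTopology α] (θ : ℝ) :
    ∃ C : ℕ → Set (ℕ → α), (∀ n, IsClosed (C n)) ∧
      {w | θ < A.positiveLang LimInf w} = ⋃ n, C n := by
  let D : ℕ → ℕ → (ℕ → ℚ) → Prop := fun N k v => ∀ n < k, N ≤ n → θ < v n
  -- By continuity from above, a decreasing sequence of events has an intersection of positive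
  -- measure exactly when some level `1 / (m + 1)` bounds all their measures from below.
  let C : ℕ × ℕ → Set (ℕ → α) := fun p =>
    ⋂ k, {w | ((p.2 : ℝ≥0∞) + 1)⁻¹ ≤ A.runMeasure w {r | D p.1 k (A.weights w r)}}
  have hmeas : ∀ N k w, MeasurableSet {r : ℕ → A.Q | D N k (A.weights w r)} := fun N k w => by
    have : {r : ℕ → A.Q | D N k (A.weights w r)} =
        ⋂ n, ⋂ (_ : n < k), ⋂ (_ : N ≤ n), {r | θ < A.weights w r n} := by ext; simp [D]
    rw [this]
    exact .iInter fun n => .iInter fun _ => .iInter fun _ =>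
      A.measurableSet_weights w (fun x => θ < x) n
  refine ⟨fun n => C n.unpair, fun n => isClosed_iInter fun k => ?_, ?_⟩
  · refine A.isClosed_le_runMeasure _ k (D _ k) (hmeas _ k) fun v v' h hv m hm hN => ?_
    rw [← h m hm]; exact hv m hm hN
  · have e : ⋃ n : ℕ, C n.unpair = ⋃ p, C p :=
      Nat.surjective_unpair.iUnion_comp C
    rw [e]
    ext w
    simp only [Set.mem_ofPred_eq, lt_positiveLang_LimInf_iff, Set.mem_iUnion, Prod.exists, C,
      Set.mem_iInter]
    refine exists_congr fun N => ?_
    constructor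
    · intro h
      obtain ⟨m, hm⟩ := ENNReal.exists_inv_nat_lt (ne_of_gt h)
      refine ⟨m, fun k => ?_⟩
      refine (ENNReal.inv_le_inv.2 le_self_add).trans (hm.le.trans (measure_mono fun r hr => ?_))
      exact hr k
    · rintro ⟨m, hm⟩
      have hI : {r : ℕ → A.Q | ∀ k, ∀ n < k, N ≤ n → θ < A.weights w r n} =
          ⋂ k, {r | D N k (A.weights w r)} := by ext; simp [D]
      have hanti : Antitone fun k => {r : ℕ → A.Q | D N k (A.weights w r)} :=
        fun k l hkl r hr n hn => hr n (by lia)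
      rw [hI, hanti.measure_iInter (fun k => (hmeas N k w).nullMeasurableSet) ⟨0, measure_ne_top _ _⟩]
      refine lt_of_lt_of_le ?_ (le_iInf hm)
      exact ENNReal.inv_pos.2 (by finiteness)

end ProbWeightedAutomaton

/-! ### The dichotomy for paths of the flow. -/

lemma frequently_add_atTop_iff {P : ℕ → Prop} (n : ℕ) :
    (∃ᶠ j in atTop, P (n + j)) ↔ ∃ᶠ j in atTop, P j := by
  conv_rhs => rw [← map_add_atTop_eq_nat n, frequently_map]
  simp only [add_comm]

namespace ProbWeightedAutomaton

section Dichotomy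

variable {α : Type} (A : ProbWeightedAutomaton α) (w : ℕ → α)

/-- The possible successors of the states in `S` under the letter `a`. -/
def post (a : α) (S : Set A.Q) : Set A.Q := {q' | ∃ q ∈ S, 0 < A.trans q a q'}

/-- The states that are reachable at time `n`. -/
def reach : ℕ → Set A.Q
  | 0 => {q | 0 < A.init q}
  | n + 1 => A.post (w n) (reach n)

variable {X : Type*} (g : A.Q → α → X → A.Q)

/-- The noise for which the weights from the state `q` on exceed `θ` infinitely often. -/
def exceeds (θ : ℚ) (w : ℕ → α) (q : A.Q) : Set (ℕ → X) :=
  {ω | ∃ᶠ n in atTop, θ < A.weights w (drive g w q ω) n}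

variable {g}

lemma suffix_mem_exceeds_iff (θ : ℚ) (q : A.Q) (ω : ℕ → X) (n : ℕ) :
    suffix n ω ∈ A.exceeds g θ (suffix n w) (drive g w q ω n) ↔ ω ∈ A.exceeds g θ w q := by
  have e : ∀ j, A.weights (suffix n w) (drive g (suffix n w) (drive g w q ω n) (suffix n ω)) j =
      A.weights w (drive g w q ω) (n + j) := fun j => by
    simp only [weights]
    rw [add_assoc, drive_add w q ω n j, drive_add w q ω n (j + 1)]; rfl
  change (∃ᶠ j in atTop, _) ↔ ∃ᶠ j in atTop, _
  simp_rw [e]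
  exact frequently_add_atTop_iff (P := fun j => θ < A.weights w (drive g w q ω) j) n

lemma drive_mem_reach {ω : ℕ → X} (hω : ∀ n q, 0 < A.trans q (w n) (g q (w n) (ω n))) {q : A.Q}
    (hq : 0 < A.init q) (n : ℕ) : drive g w q ω n ∈ A.reach w n := by
  induction n with
  | zero => exact hq
  | succ n ih => exact ⟨_, ih, hω n _⟩

variable [Finite X] [MeasurableSpace X] [DiscreteMeasurableSpace X]

lemma measurableSet_exceeds (θ : ℚ) (q : A.Q) : MeasurableSet (A.exceeds g θ w q) :=
  measurable_drive_right w q (A.measurableSet_frequently_weights w fun x => θ < x)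

variable {μ : Measure X} [IsProbabilityMeasure μ]

/-- A successor is entered with positive probability, independently of the later noise; a positive
chance of exceeding from there would be one from its predecessor. -/
lemma iid_exceeds_of_mem_reach (hg : ∀ q a q', μ {x | g q a x = q'} = A.trans q a q') {θ : ℚ}
    (h : ∀ q, 0 < A.init q → iid μ (A.exceeds g θ w q) = 0) (n : ℕ) :
    ∀ q ∈ A.reach w n, iid μ (A.exceeds g θ (suffix n w) q) = 0 := by
  induction n with
  | zero =>
    intro q hq
    have : suffix 0 w = w := by ext i; simp [suffix]
    rw [this]; exact h q hq
  | succ n ih =>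
    rintro q' ⟨q, hq, hpos⟩
    have h1 := iid_pi_inter_preimage_suffix μ 1 (t := fun _ => {x | g q (w n) x = q'})
      (fun _ => .of_discrete) (A.measurableSet_exceeds (g := g) (suffix (n + 1) w) θ q')
    rw [measure_mono_null ?_ (ih q hq)] at h1
    · simp only [Finset.range_one, Finset.prod_singleton, hg] at h1
      exact (mul_eq_zero.1 h1.symm).resolve_left hpos.ne'
    · rintro ω ⟨h0, hω⟩
      have h0' : g q (w n) (ω 0) = q' := h0 0 (by simp)
      rw [← A.suffix_mem_exceeds_iff (suffix n w) θ q ω 1, suffix_suffix]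
      change suffix 1 ω ∈ A.exceeds g θ _ (g q (w n) (ω 0))
      rw [h0']; exact hω

lemma ae_forall_notMem_exceeds (hg : ∀ q a q', μ {x | g q a x = q'} = A.trans q a q') {θ : ℚ}
    (h : A.runMeasure w {r | ∃ᶠ n in atTop, θ < A.weights w r n} = 0) :
    ∀ᵐ ω ∂iid μ, ∀ n, ∀ q ∈ A.reach w n, suffix n ω ∉ A.exceeds g θ (suffix n w) q := by
  rw [A.runMeasure_eq_zero_iff w hg (A.measurableSet_frequently_weights w fun x => θ < x)] at h
  have h' := A.iid_exceeds_of_mem_reach w hg h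
  rw [ae_all_iff]; intro n
  rw [ae_all_iff]; intro q
  by_cases hq : q ∈ A.reach w n
  · have : ∀ᵐ ω ∂iid μ, suffix n ω ∉ A.exceeds g θ (suffix n w) q := by
      rw [ae_iff]; simp only [not_not]
      rw [← h' n q hq]
      exact iid_preimage_suffix μ n (A.measurableSet_exceeds _ θ q)
    filter_upwards [this] with ω hω _ using hω
  · exact Eventually.of_forall fun ω hq' => absurd hq' hq

/-- By the zero-one law, if a run exceeds `θ` infinitely often with positive probability, then almost
surely some path of the flow does so. -/
lemma ae_exists_mem_exceeds (hg : ∀ q a q', μ {x | g q a x = q'} = A.trans q a q') {θ : ℚ}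
    (h : A.runMeasure w {r | ∃ᶠ n in atTop, θ < A.weights w r n} ≠ 0) :
    ∀ᵐ ω ∂iid μ, ∃ n, ∃ q ∈ A.reach w n, suffix n ω ∈ A.exceeds g θ (suffix n w) q := by
  rw [Ne, A.runMeasure_eq_zero_iff w hg (A.measurableSet_frequently_weights w fun x => θ < x)] at h
  push Not at h
  obtain ⟨q₀, hq₀, hpos⟩ := h
  -- Asking for infinitely many `n` makes `E` a tail event. It contains the event for `q₀`, since an
  -- exceeding path does so from each of its own later states.
  let E : Set (ℕ → X) :=
    {ω | ∃ᶠ n in atTop, ω ∈ {ω | ∃ q ∈ A.reach w n, suffix n ω ∈ A.exceeds g θ (suffix n w) q}}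
  have hmeas : ∀ N, MeasurableSet[⨆ i ∈ Set.Ici N, coordAlgebra X i] E := by
    intro N
    have e : E = {ω | ∃ᶠ n in atTop, ω ∈ {ω | ∃ q ∈ A.reach w (N + n),
        suffix (N + n) ω ∈ A.exceeds g θ (suffix (N + n) w) q}} := by
      ext ω
      exact (frequently_add_atTop_iff N).symm
    rw [e]
    refine measurableSet_frequently (m := ⨆ i ∈ Set.Ici N, coordAlgebra X i) fun n => ?_
    have : {ω : ℕ → X | ∃ q ∈ A.reach w (N + n),
        suffix (N + n) ω ∈ A.exceeds g θ (suffix (N + n) w) q} =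
        ⋃ q ∈ A.reach w (N + n), suffix (N + n) ⁻¹' A.exceeds g θ (suffix (N + n) w) q := by
      ext; simp
    rw [this]
    exact MeasurableSet.biUnion (Set.to_countable _) fun q _ =>
      measurableSet_preimage_suffix (by lia) (A.measurableSet_exceeds _ θ q)
  have hE : iid μ E = 1 := by
    refine (iid_tail_zero_or_one μ hmeas).resolve_left fun h0 => hpos ?_
    refine measure_mono_null_ae ?_ h0
    filter_upwards [A.ae_trans_pos w hg] with ω hω hω₀
    exact Frequently.of_forall fun n => ⟨_, A.drive_mem_reach w hω hq₀ n,
      (A.suffix_mem_exceeds_iff w θ q₀ ω n).2 hω₀⟩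
  have hE' : ∀ᵐ ω ∂iid μ, ω ∈ E :=
    (mem_ae_iff_prob_eq_one (iSup₂_le (fun i _ => coordAlgebra_le i) _ (hmeas 0))).2 hE
  filter_upwards [hE'] with ω hω using Frequently.exists hω

end Dichotomy

end ProbWeightedAutomaton

/-! ### The dual automaton. -/

lemma map_toPMF_apply {X Y : Type*} [MeasurableSpace X] [DiscreteMeasurableSpace X] [Countable X]
    (μ : Measure X) [IsProbabilityMeasure μ] (f : X → Y) (y : Y) :
    μ.toPMF.map f y = μ {x | f x = y} := by
  let _ : MeasurableSpace Y := ⊤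
  have h := PMF.toMeasure_map_apply f μ.toPMF {y} .of_discrete .of_discrete
  rw [Measure.toPMF_toMeasure, PMF.toMeasure_apply_singleton _ _ (measurableSet_singleton _)] at h
  exact h

namespace ProbWeightedAutomaton

section Dual

variable {α : Type} (A : ProbWeightedAutomaton α)

/-- The transitions, as names for the weights. -/
abbrev Edge : Type := A.Q × α × A.Q

/-- The weight of a transition. -/
def edgeWeight (k : A.Edge) : ℚ := A.weight k.1 k.2.1 k.2.2

/-- A guess of a weight and of a set of states, or the decision to wait. -/
def Guess : Type := Option (A.Edge × Set A.Q)

instance : MeasurableSpace A.Guess := ⊤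

instance : DiscreteMeasurableSpace A.Guess := ⟨fun _ => trivial⟩

instance [Finite α] : Finite A.Guess := inferInstanceAs (Finite (Option (A.Edge × Set A.Q)))

instance : Nonempty A.Guess := ⟨(none : Option (A.Edge × Set A.Q))⟩

noncomputable instance [Finite α] : Fintype A.Guess := Fintype.ofFinite _

/-- The uniform law on the guesses. -/
noncomputable def guessLaw [Finite α] : Measure A.Guess :=
  (PMF.uniformOfFintype A.Guess).toMeasure

instance [Finite α] : IsProbabilityMeasure A.guessLaw := PMF.toMeasure.isProbabilityMeasure _

lemma guessLaw_singleton_pos [Finite α] (c : A.Guess) : 0 < A.guessLaw {c} := by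
  unfold guessLaw
  rw [PMF.toMeasure_apply_singleton _ _ (measurableSet_singleton _), PMF.uniformOfFintype_apply]
  simp

/-- A move of every state, and a guess. -/
abbrev Noise : Type := (α × A.Q → A.Q) × A.Guess

/-- The law of an independent pair of moves and guess. -/
noncomputable abbrev noiseLaw [Finite α] : Measure A.Noise := A.moveLaw.prod A.guessLaw

/-- The update function of `A`, which ignores the guesses. -/
def follow (q : A.Q) (a : α) (x : A.Noise) : A.Q := x.1 (a, q)

lemma noiseLaw_follow [Finite α] (q : A.Q) (a : α) (q' : A.Q) :
    A.noiseLaw {x | A.follow q a x = q'} = A.trans q a q' := by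
  have : {x : A.Noise | A.follow q a x = q'} = {u | u (a, q) = q'} ×ˢ Set.univ := by
    ext; simp [follow]
  rw [this, Measure.prod_prod, moveLaw_apply, measure_univ, mul_one]

/-- The states of the dual automaton: the reachable states of `A`, and after the guess the guessed
weight and the two sets of a breakpoint evolution. -/
abbrev DualState : Type := Set A.Q × Option (A.Edge × Set A.Q × Set A.Q)

/-- The states in `T` that take a transition of weight at most that of `k`, moved. -/
def dualTarget (k : A.Edge) (T : Set A.Q) (a : α) (x : A.Noise) : Set A.Q :=
  (fun q => A.follow q a x) '' {q ∈ T | ¬ A.edgeWeight k < A.weight q a (A.follow q a x)}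

open Classical in
/-- The update function of the dual automaton. -/
noncomputable def dualUpdate (s : A.DualState) (a : α) (x : A.Noise) : A.DualState :=
  (A.post a s.1,
    match s.2 with
    -- A guess starts with `B` empty, so at a breakpoint; without a guess the automaton waits. Later
    -- guesses are ignored.
    | none => Option.map (fun c => (c.1, c.2, ∅)) x.2
    | some (k, T, B) => some (k, A.dualTarget k T a x,
        (if B = ∅ then A.post a s.1 else (fun q => A.follow q a x) '' B) \ A.dualTarget k T a x))

open Classical in
/-- The dual automaton: it visits breakpoints infinitely often if all paths of the flow exceed the
guessed weight only finitely often. -/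
noncomputable def dual [Finite α] (k₀ : A.Edge) : ProbWeightedAutomaton α where
  Q := A.DualState
  finite_Q := inferInstance
  init := PMF.pure ({q | 0 < A.init q}, none)
  trans s a := A.noiseLaw.toPMF.map (A.dualUpdate s a)
  weight s _ _ :=
    match s.2 with
    -- With `k₀` of maximal weight, as in the application, this is the least weight.
    | none => -A.edgeWeight k₀
    | some (k, _, B) => if B = ∅ then -A.edgeWeight k else -A.edgeWeight k₀

lemma noiseLaw_dualUpdate [Finite α] (k₀ : A.Edge) (s : (A.dual k₀).Q) (a : α) (s' : (A.dual k₀).Q) :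
    A.noiseLaw {x | (A.dualUpdate s a x : (A.dual k₀).Q) = s'} = (A.dual k₀).trans s a s' :=
  (map_toPMF_apply _ _ _).symm

variable (w : ℕ → α) (ω : ℕ → A.Noise)

/-- The state of the dual automaton at time `n`. -/
noncomputable abbrev dualRun : ℕ → A.DualState :=
  drive A.dualUpdate w ({q | 0 < A.init q}, none) ω

/-- The move of the states at time `n`. -/
def moveAt (n : ℕ) (q : A.Q) : A.Q := A.follow q (w n) (ω n)

/-- The state `q` takes a transition of weight more than `θ` at time `n`. -/
def ExceedsAt (θ : ℚ) (n : ℕ) (q : A.Q) : Prop := θ < A.weight q (w n) (A.moveAt w ω n q)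

lemma dualRun_fst (n : ℕ) : (A.dualRun w ω n).1 = A.reach w n := by
  induction n with
  | zero => rfl
  | succ n ih =>
    change A.post (w n) (A.dualRun w ω n).1 = A.post (w n) _
    rw [ih]

lemma drive_follow_suffix (n : ℕ) (q : A.Q) (j : ℕ) :
    drive A.follow (suffix n w) q (suffix n ω) j = flow (A.moveAt w ω) n j q := by
  induction j with
  | zero => rfl
  | succ j ih =>
    change A.follow (drive A.follow (suffix n w) q (suffix n ω) j) _ _ = _
    rw [ih]; rfl

lemma suffix_mem_exceeds_iff_exceedsAt (θ : ℚ) (n : ℕ) (q : A.Q) :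
    suffix n ω ∈ A.exceeds A.follow θ (suffix n w) q ↔
      ∃ᶠ j in atTop, A.ExceedsAt w ω θ (n + j) (flow (A.moveAt w ω) n j q) := by
  refine frequently_congr (Eventually.of_forall fun j => ?_)
  simp only [weights, drive_follow_suffix]
  rfl

lemma exists_breakpointEvolution {N : ℕ} {k : A.Edge} {T₀ B₀ : Set A.Q}
    (hN : (A.dualRun w ω N).2 = some (k, T₀, B₀)) :
    ∃ T B : ℕ → Set A.Q, T N = T₀ ∧ B N = B₀ ∧
      (∀ n ≥ N, (A.dualRun w ω n).2 = some (k, T n, B n)) ∧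
      BreakpointEvolution (A.moveAt w ω) (A.reach w) (A.ExceedsAt w ω (A.edgeWeight k)) T B N := by
  classical
  have step : ∀ n T B, (A.dualRun w ω n).2 = some (k, T, B) →
      (A.dualRun w ω (n + 1)).2 = some (k, A.dualTarget k T (w n) (ω n),
        (if B = ∅ then A.reach w (n + 1) else A.moveAt w ω n '' B) \
          A.dualTarget k T (w n) (ω n)) := by
    intro n T B h
    change (A.dualUpdate (A.dualRun w ω n) (w n) (ω n)).2 = _
    unfold dualUpdate
    simp only [h, dualRun_fst]
    rfl
  have hex : ∀ n ≥ N, ∃ p : Set A.Q × Set A.Q, (A.dualRun w ω n).2 = some (k, p.1, p.2) := by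
    intro n hn
    induction n, hn using Nat.le_induction with
    | base => exact ⟨(T₀, B₀), hN⟩
    | succ n hn ih =>
      obtain ⟨p, hp⟩ := ih
      exact ⟨(_, _), step n _ _ hp⟩
  choose! p hp using hex
  have hpN : p N = (T₀, B₀) := by
    have := (hp N le_rfl).symm.trans hN
    simpa [Prod.ext_iff] using this
  have hstep : ∀ n ≥ N, p (n + 1) = (A.dualTarget k (p n).1 (w n) (ω n),
      (if (p n).2 = ∅ then A.reach w (n + 1) else A.moveAt w ω n '' (p n).2) \
          A.dualTarget k (p n).1 (w n) (ω n)) := fun n hn => by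
    have := (hp (n + 1) (by lia)).symm.trans (step n _ _ (hp n hn))
    simpa [Prod.ext_iff] using this
  refine ⟨fun n => (p n).1, fun n => (p n).2, congrArg Prod.fst hpN, congrArg Prod.snd hpN, hp, ?_, ?_, ?_⟩
  · intro n hn
    simp only [hstep n hn]; rfl
  · intro n hn hB
    simp only [hstep n hn]; rw [if_pos hB]
  · intro n hn hB
    simp only [hstep n hn]; rw [if_neg hB]

variable {w ω}

lemma moveAt_mem_reach (hω : ∀ n q, 0 < A.trans q (w n) (A.follow q (w n) (ω n))) (n : ℕ) (q : A.Q)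
    (hq : q ∈ A.reach w n) : A.moveAt w ω n q ∈ A.reach w (n + 1) :=
  ⟨q, hq, hω n q⟩

/-- A guess once made is kept, so the breakpoints all belong to one breakpoint evolution, which
makes every path eventually good. -/
lemma exists_forall_notMem_exceeds (hω : ∀ n q, 0 < A.trans q (w n) (A.follow q (w n) (ω n)))
    {P : A.Edge → Prop}
    (h : ∃ᶠ n in atTop, ∃ k T, P k ∧ (A.dualRun w ω n).2 = some (k, T, ∅)) :
    ∃ k, P k ∧ ∀ n, ∀ q ∈ A.reach w n, suffix n ω ∉ A.exceeds A.follow (A.edgeWeight k) (suffix n w) q := by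
  obtain ⟨N, k, T₀, hk, hN⟩ := h.exists
  obtain ⟨T, B, -, -, hTB, hevo⟩ := A.exists_breakpointEvolution w ω hN
  have hB : ∃ᶠ n in atTop, B n = ∅ := by
    refine (h.and_eventually (eventually_ge_atTop N)).mono ?_
    rintro n ⟨⟨k', T', -, hn⟩, hNn⟩
    have := (hTB n hNn).symm.trans hn
    simp only [Option.some.injEq, Prod.mk.injEq] at this
    exact this.2.2
  refine ⟨k, hk, fun n q hq => ?_⟩
  rw [suffix_mem_exceeds_iff_exceedsAt, not_frequently]
  have hx := hevo.eventually_not_bad hB (M := n)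
    (x := fun m => flow (A.moveAt w ω) n (m - n) q) (fun m hm => ?_) fun m hm => ?_
  · obtain ⟨M, hM⟩ := eventually_atTop.1 hx
    filter_upwards [eventually_ge_atTop M] with j hj
    simpa using hM (n + j) (by lia)
  · have := flow_mem (A.moveAt_mem_reach hω) hq (m - n)
    rwa [Nat.add_sub_cancel' hm] at this
  · obtain ⟨j, rfl⟩ := Nat.exists_eq_add_of_le hm
    rw [add_assoc, Nat.add_sub_cancel_left, Nat.add_sub_cancel_left]; rfl

/-- The noise for which a dual run that has just guessed `k` and `T₀` visits breakpoints forever. -/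
def guessSucceeds (w : ℕ → α) (k : A.Edge) (T₀ : Set A.Q) (N : ℕ) : Set (ℕ → A.Noise) :=
  {ω | ∃ᶠ n in atTop, ∃ T, (drive A.dualUpdate (suffix N w) (A.reach w N, some (k, T₀, ∅)) ω n).2 =
    some (k, T, ∅)}

/-- Wait until time `N` and then guess `k` and `T₀`. -/
def waitThenGuess (k : A.Edge) (T₀ : Set A.Q) (N : ℕ) (i : ℕ) : A.Guess :=
  if i < N then (none : Option (A.Edge × Set A.Q)) else some (k, T₀)

lemma waitThenGuess_of_lt (k : A.Edge) (T₀ : Set A.Q) {N i : ℕ} (h : i < N) :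
    A.waitThenGuess k T₀ N i = (none : Option (A.Edge × Set A.Q)) := if_pos h

lemma waitThenGuess_self (k : A.Edge) (T₀ : Set A.Q) (N : ℕ) :
    A.waitThenGuess k T₀ N N = some (k, T₀) := if_neg (lt_irrefl N)

/-- The noise for which the dual run waits until time `N` and then guesses `k` and `T₀`. -/
def guessNoise (k : A.Edge) (T₀ : Set A.Q) (N : ℕ) (i : ℕ) : Set A.Noise :=
  Set.univ ×ˢ {A.waitThenGuess k T₀ N i}

lemma dualRun_of_guessNoise {k : A.Edge} {T₀ : Set A.Q} {N : ℕ}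
    (h : ω ∈ Set.pi (Finset.range (N + 1)) (A.guessNoise k T₀ N)) :
    A.dualRun w ω (N + 1) = (A.reach w (N + 1), some (k, T₀, ∅)) := by
  have hg : ∀ i ≤ N, (ω i).2 = A.waitThenGuess k T₀ N i := fun i hi =>
    (h i (by simp; lia)).2
  have hwait : ∀ i ≤ N, (A.dualRun w ω i).2 = none := by
    intro i hi
    induction i with
    | zero => rfl
    | succ i ih =>
      change (A.dualUpdate (A.dualRun w ω i) (w i) (ω i)).2 = none
      unfold dualUpdate
      simp only [ih (by lia)]
      exact congrArg (Option.map _) ((hg i (by lia)).trans (A.waitThenGuess_of_lt k T₀ (by lia)))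
  refine Prod.ext (A.dualRun_fst w ω (N + 1)) ?_
  change (A.dualUpdate (A.dualRun w ω N) (w N) (ω N)).2 = _
  unfold dualUpdate
  simp only [hwait N le_rfl]
  exact congrArg (Option.map _) ((hg N le_rfl).trans (A.waitThenGuess_self k T₀ N))

/-- The time and set come from the coalescence argument. Only the early guesses of the noise are
overwritten, so the moves and the suffix are unchanged. -/
lemma exists_suffix_mem_guessSucceeds
    (hω : ∀ n q, 0 < A.trans q (w n) (A.follow q (w n) (ω n))) {k : A.Edge}
    (h : ∀ n, ∀ q ∈ A.reach w n, suffix n ω ∉ A.exceeds A.follow (A.edgeWeight k) (suffix n w) q) :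
    ∃ N T₀, suffix (N + 1) ω ∈ A.guessSucceeds w k T₀ (N + 1) := by
  obtain ⟨N, hN, T₀, hT₀⟩ := exists_frequently_breakpoint (f := A.moveAt w ω) (S := A.reach w)
    (bad := A.ExceedsAt w ω (A.edgeWeight k)) (A.moveAt_mem_reach hω) fun n q hq => by
      have := h n q hq
      rwa [suffix_mem_exceeds_iff_exceedsAt, not_frequently] at this
  obtain ⟨N, rfl⟩ := Nat.exists_eq_add_of_lt hN
  rw [zero_add] at hT₀
  refine ⟨N, T₀, ?_⟩
  let ω' : ℕ → A.Noise := fun i =>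
    ((ω i).1, if i ≤ N then A.waitThenGuess k T₀ N i else (ω i).2)
  have hrun : A.dualRun w ω' (N + 1) = (A.reach w (N + 1), some (k, T₀, ∅)) := by
    refine A.dualRun_of_guessNoise fun i hi => ⟨trivial, ?_⟩
    have hi' : i < N + 1 := by simpa using hi
    exact if_pos (by lia)
  have hsuffix : suffix (N + 1) ω' = suffix (N + 1) ω := by
    ext1 i
    exact Prod.ext rfl (if_neg (by lia))
  obtain ⟨T, B, hTN, hBN, hTB, hevo⟩ :=
    A.exists_breakpointEvolution w ω' (N := N + 1) (congrArg Prod.snd hrun)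
  have hfreq := hT₀ T B hTN hBN hevo
  rw [← frequently_add_atTop_iff (N + 1)] at hfreq
  refine hfreq.mono fun j hj => ⟨T (N + 1 + j), ?_⟩
  rw [← hsuffix, ← hrun, ← drive_add, ← hj]
  exact hTB _ (by lia)

lemma measurableSet_guessSucceeds [Finite α] (k : A.Edge) (T₀ : Set A.Q) (N : ℕ) :
    MeasurableSet (A.guessSucceeds w k T₀ N) := by
  let _ : MeasurableSpace A.DualState := ⊤
  have : DiscreteMeasurableSpace A.DualState := ⟨fun _ => trivial⟩
  refine measurableSet_frequently fun n => ?_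
  have h : Measurable fun ω : ℕ → A.Noise =>
      drive A.dualUpdate (suffix N w) (A.reach w N, some (k, T₀, ∅)) ω n :=
    (measurable_pi_apply n).comp (measurable_drive_right _ _)
  exact h (.of_discrete : MeasurableSet {s : A.DualState | ∃ T, s.2 = some (k, T, ∅)})

/-- If the runs of `A` almost surely exceed the weight of `k` only finitely often, then the dual
automaton guesses `k` and visits breakpoints infinitely often with positive probability. -/
lemma iid_frequently_breakpoint_pos [Finite α] {k : A.Edge}
    (h : A.runMeasure w {r | ∃ᶠ n in atTop, A.edgeWeight k < A.weights w r n} = 0) :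
    0 < iid A.noiseLaw {ω | ∃ᶠ n in atTop, ∃ T, (A.dualRun w ω n).2 = some (k, T, ∅)} := by
  have h1 : ∀ᵐ ω ∂iid A.noiseLaw, ω ∈ ⋃ N, ⋃ T₀, suffix (N + 1) ⁻¹' A.guessSucceeds w k T₀ (N + 1) := by
    filter_upwards [A.ae_trans_pos w A.noiseLaw_follow,
      A.ae_forall_notMem_exceeds w A.noiseLaw_follow h] with ω hω hno
    obtain ⟨N, T₀, hmem⟩ := A.exists_suffix_mem_guessSucceeds hω hno
    exact Set.mem_iUnion₂.2 ⟨N, T₀, hmem⟩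
  have h2 : iid A.noiseLaw (⋃ N, ⋃ T₀, suffix (N + 1) ⁻¹' A.guessSucceeds w k T₀ (N + 1)) ≠ 0 := by
    intro h0
    have := measure_eq_zero_iff_ae_notMem.1 h0
    obtain ⟨ω, hω, hω'⟩ := (h1.and this).exists
    exact hω' hω
  -- The good time and set depend on the noise, but there are countably many pairs, so a fixed one
  -- succeeds with positive probability. The guesses leading to it are independent of the suffix.
  obtain ⟨N, hN⟩ := exists_measure_pos_of_not_measure_iUnion_null h2
  obtain ⟨T₀, hT₀⟩ := exists_measure_pos_of_not_measure_iUnion_null hN.ne'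
  rw [iid_preimage_suffix _ _ (A.measurableSet_guessSucceeds k T₀ (N + 1))] at hT₀
  have h3 := iid_pi_inter_preimage_suffix A.noiseLaw (N + 1) (t := A.guessNoise k T₀ N)
    (fun _ => .of_discrete) (A.measurableSet_guessSucceeds (w := w) k T₀ (N + 1))
  have hpos : 0 < (∏ i ∈ Finset.range (N + 1), A.noiseLaw (A.guessNoise k T₀ N i)) *
      iid A.noiseLaw (A.guessSucceeds w k T₀ (N + 1)) := by
    refine ENNReal.mul_pos (Finset.prod_ne_zero_iff.2 fun i _ => ?_) hT₀.ne'
    rw [guessNoise, Measure.prod_prod, measure_univ, one_mul]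
    exact (A.guessLaw_singleton_pos _).ne'
  rw [← h3] at hpos
  refine hpos.trans_le (measure_mono ?_)
  rintro ω ⟨hω, hsucc⟩
  have hrun : drive A.dualUpdate w ({q | 0 < A.init q}, none) ω (N + 1) = _ :=
    A.dualRun_of_guessNoise hω
  refine (frequently_add_atTop_iff (N + 1)).1 ?_
  refine Frequently.mono hsucc fun j hj => ?_
  change ∃ T, (drive A.dualUpdate w _ ω (N + 1 + j)).2 = _
  rw [drive_add, hrun]; exact hj

/-- If the runs of `A` reach the weight `c` infinitely often with positive probability, then the dual
automaton almost surely sees only finitely many breakpoints with a guess below `c`. -/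
lemma iid_frequently_breakpoint_eq_zero [Finite α] {c : ℚ}
    (h : A.runMeasure w {r | ∃ᶠ n in atTop, c ≤ A.weights w r n} ≠ 0) :
    iid A.noiseLaw {ω | ∃ᶠ n in atTop, ∃ k T, A.edgeWeight k < c ∧
      (A.dualRun w ω n).2 = some (k, T, ∅)} = 0 := by
  have h1 : ∀ᵐ ω ∂iid A.noiseLaw, ∀ k, A.edgeWeight k < c → ∃ n, ∃ q ∈ A.reach w n,
      suffix n ω ∈ A.exceeds A.follow (A.edgeWeight k) (suffix n w) q := by
    rw [ae_all_iff]; intro k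
    by_cases hk : A.edgeWeight k < c
    · have := A.ae_exists_mem_exceeds w A.noiseLaw_follow (θ := A.edgeWeight k) fun h0 => h
        (measure_mono_null (fun r (hr : ∃ᶠ n in atTop, _) => hr.mono fun n => hk.trans_le) h0)
      filter_upwards [this] with ω hω _ using hω
    · exact Eventually.of_forall fun _ hk' => absurd hk' hk
  rw [measure_eq_zero_iff_ae_notMem]
  filter_upwards [h1, A.ae_trans_pos w A.noiseLaw_follow] with ω hω hpos hfreq
  obtain ⟨k, hk, hno⟩ := A.exists_forall_notMem_exceeds hpos hfreq
  obtain ⟨n, q, hq, hmem⟩ := hω k hk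
  exact hno n q hq hmem

end Dual

end ProbWeightedAutomaton

/-! ### The language of the dual automaton. -/

namespace ProbWeightedAutomaton

section DualLanguage

variable {α : Type} [Finite α] (A : ProbWeightedAutomaton α) (w : ℕ → α)

lemma positiveLang_LimSup_eq {c : ℚ}
    (hle : A.runMeasure w {r | ∃ᶠ n in atTop, c ≤ A.weights w r n} ≠ 0)
    (hlt : A.runMeasure w {r | ∃ᶠ n in atTop, c < A.weights w r n} = 0) :
    A.positiveLang LimSup w = c := by
  rw [positiveLang_eq]
  refine IsGreatest.csSup_eq ⟨?_, fun η hη => ?_⟩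
  · refine (pos_iff_ne_zero.2 hle).trans_le (measure_mono fun r hr => ?_)
    rw [Set.mem_ofPred_eq, le_LimSup_iff (A.finite_range_weights w r)]
    exact Frequently.mono hr fun n hn => by exact_mod_cast hn
  · by_contra! h
    refine hη.ne' (measure_mono_null (fun r hr => ?_) hlt)
    rw [Set.mem_ofPred_eq, le_LimSup_iff (A.finite_range_weights w r)] at hr
    exact hr.mono fun n hn => by exact_mod_cast h.trans_le hn

/-- Take the largest weight reached infinitely often with positive probability; each of the finitely
many larger ones is almost surely reached only finitely often. -/
lemma exists_edgeWeight_attained :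
    ∃ k : A.Edge, A.runMeasure w {r | ∃ᶠ n in atTop, A.edgeWeight k ≤ A.weights w r n} ≠ 0 ∧
      A.runMeasure w {r | ∃ᶠ n in atTop, A.edgeWeight k < A.weights w r n} = 0 := by
  let D : Set A.Edge :=
    {k | A.runMeasure w {r | ∃ᶠ n in atTop, A.edgeWeight k ≤ A.weights w r n} ≠ 0}
  have hD : D.Nonempty := by
    obtain ⟨q⟩ := A.init.support_nonempty.to_type
    have : Nonempty A.Edge := ⟨(q, w 0, q)⟩
    obtain ⟨k, hk⟩ := Finite.exists_min A.edgeWeight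
    refine ⟨k, ?_⟩
    have : {r : ℕ → A.Q | ∃ᶠ n in atTop, A.edgeWeight k ≤ A.weights w r n} = Set.univ :=
      Set.eq_univ_of_forall fun r => Frequently.of_forall fun n => hk (r n, w n, r (n + 1))
    simp [D, this]
  obtain ⟨k, hk, hmax⟩ := Set.exists_max_image D A.edgeWeight D.toFinite hD
  refine ⟨k, hk, ?_⟩
  have h : ∀ᵐ r ∂A.runMeasure w, ∀ k', A.edgeWeight k < A.edgeWeight k' →
      ∀ᶠ n in atTop, ¬ A.edgeWeight k' ≤ A.weights w r n := by
    rw [ae_all_iff]; intro k'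
    by_cases hk' : A.edgeWeight k < A.edgeWeight k'
    · have h0 : A.runMeasure w {r | ∃ᶠ n in atTop, A.edgeWeight k' ≤ A.weights w r n} = 0 := by
        by_contra hne
        exact absurd (hmax k' hne) (not_le.2 hk')
      filter_upwards [measure_eq_zero_iff_ae_notMem.1 h0] with r hr _ using not_frequently.1 hr
    · exact Eventually.of_forall fun _ h' => absurd h' hk'
  rw [measure_eq_zero_iff_ae_notMem]
  filter_upwards [h] with r hr
  rw [not_frequently]
  filter_upwards [eventually_all.2 fun k' => eventually_imp_distrib_left.2 (hr k')] with n hn hlt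
  exact hn (r n, w n, r (n + 1)) hlt le_rfl

variable {A}

lemma runMeasure_dual_eq_zero_iff (k₀ : A.Edge) {S : Set (ℕ → (A.dual k₀).Q)} (hS : MeasurableSet S) :
    (A.dual k₀).runMeasure w S = 0 ↔ iid A.noiseLaw {ω | (A.dualRun w ω : ℕ → (A.dual k₀).Q) ∈ S} = 0 := by
  classical
  rw [(A.dual k₀).runMeasure_eq_zero_iff w (A.noiseLaw_dualUpdate k₀) hS]
  constructor
  · intro h
    refine h (({q | 0 < A.init q}, none) : A.DualState) ?_
    change 0 < PMF.pure (({q | 0 < A.init q}, none) : A.DualState) _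
    rw [PMF.pure_apply_self]; exact one_pos
  · intro h q hq
    have : q = (({q | 0 < A.init q}, none) : A.DualState) := by
      by_contra hne
      exact hq.ne' (PMF.pure_apply_of_ne _ _ hne)
    rw [this]; exact h

/-- Let `k` carry the value of `A`. Guessing `k` succeeds with positive probability and yields
`-A.edgeWeight k`. A larger weight needs a breakpoint with a smaller guess, and these almost surely
occur only finitely often. -/
lemma positiveLang_LimSup_dual {k₀ : A.Edge} (hk₀ : ∀ k, A.edgeWeight k ≤ A.edgeWeight k₀) :
    (A.dual k₀).positiveLang LimSup w = -A.positiveLang LimSup w := by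
  obtain ⟨k, hle, hlt⟩ := A.exists_edgeWeight_attained w
  rw [A.positiveLang_LimSup_eq w hle hlt, ← Rat.cast_neg]
  refine (A.dual k₀).positiveLang_LimSup_eq w ?_ ?_
  · rw [Ne, runMeasure_dual_eq_zero_iff w k₀
      ((A.dual k₀).measurableSet_frequently_weights w fun x => -A.edgeWeight k ≤ x)]
    refine ((A.iid_frequently_breakpoint_pos hlt).trans_le (measure_mono fun ω hω => ?_)).ne'
    refine Frequently.mono hω ?_
    rintro n ⟨T, hT⟩
    simp only [weights, dual, hT]
    simp
  · rw [runMeasure_dual_eq_zero_iff w k₀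
      ((A.dual k₀).measurableSet_frequently_weights w fun x => -A.edgeWeight k < x)]
    refine measure_mono_null (fun ω hω => ?_) (A.iid_frequently_breakpoint_eq_zero hle)
    refine Frequently.mono hω fun n hn => ?_
    have hk := hk₀ k
    simp only [weights, dual] at hn
    split at hn
    · linarith
    · rename_i k' T B heq
      split_ifs at hn with hB
      · exact ⟨k', T, by linarith, hB ▸ heq⟩
      · linarith

variable (A)

lemma exists_positiveLang_LimSup_eq_neg : ∃ A' : ProbWeightedAutomaton α,
    ∀ w, A'.positiveLang LimSup w = -A.positiveLang LimSup w := by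
  rcases isEmpty_or_nonempty α with _ | ⟨⟨a⟩⟩
  · exact ⟨A, fun w => isEmptyElim (w 0)⟩
  · obtain ⟨q⟩ := A.init.support_nonempty.to_type
    have : Nonempty A.Edge := ⟨(q, a, q)⟩
    obtain ⟨k₀, hk₀⟩ := Finite.exists_max A.edgeWeight
    exact ⟨A.dual k₀, fun w => positiveLang_LimSup_dual w hk₀⟩

end DualLanguage

/-! ### The separating automaton. -/

/-- The automaton with a single state that gives weight `1` to the letter `true`. -/
noncomputable def detectTrue : ProbWeightedAutomaton Bool where
  Q := Unit
  finite_Q := inferInstance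
  init := PMF.pure ()
  trans _ _ := PMF.pure ()
  weight _ b _ := if b then 1 else 0

lemma almostSureLang_detectTrue (w : ℕ → Bool) :
    detectTrue.almostSureLang LimSup w = LimSup fun n => if w n then 1 else 0 := by
  rw [almostSureLang_eq]
  refine IsGreatest.csSup_eq ⟨?_, fun η hη => ?_⟩
  · have : {r : ℕ → detectTrue.Q | (LimSup fun n => if w n then 1 else 0) ≤
        LimSup (detectTrue.weights w r)} = Set.univ := Set.eq_univ_of_forall fun r => le_refl (LimSup _)
    rw [Set.mem_ofPred_eq, this, measure_univ]
  · obtain ⟨r, hr⟩ := nonempty_of_measure_ne_zero (ne_of_eq_of_ne hη one_ne_zero)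
    exact hr

lemma lt_almostSureLang_detectTrue_iff (w : ℕ → Bool) :
    2⁻¹ < detectTrue.almostSureLang LimSup w ↔ ∃ᶠ n in atTop, w n = true := by
  have hfin : (Set.range fun n => if w n then (1 : ℚ) else 0).Finite :=
    (Set.finite_range fun b : Bool => if b then (1 : ℚ) else 0).subset
      (Set.range_comp_subset_range w fun b : Bool => if b then (1 : ℚ) else 0)
  rw [almostSureLang_detectTrue, lt_LimSup_iff hfin]
  refine frequently_congr (Eventually.of_forall fun n => ?_)
  cases w n <;> norm_num

lemma not_positiveLang_LimInf_eq_detectTrue (A : ProbWeightedAutomaton Bool) :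
    ¬ ∀ w, detectTrue.almostSureLang LimSup w = A.positiveLang LimInf w := by
  intro h
  obtain ⟨C, hC, hU⟩ := A.exists_isClosed_iUnion_eq 2⁻¹
  refine infinitely_many_true_ne_iUnion_isClosed C hC ?_
  rw [← hU]
  ext w
  rw [Set.mem_ofPred_eq, Set.mem_ofPred_eq, ← h w, lt_almostSureLang_detectTrue_iff]

end ProbWeightedAutomaton

theorem mainTheorem5 :
    (Reducible AsLimInf PosLimSup ∧ Reducible PosLimSup AsLimInf) ∧
      Incomparable AsLimSup PosLimInf := by
  refine ⟨⟨fun α _ A => ?_, fun α _ A => ?_⟩, fun h => ?_, fun h => ?_⟩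
  · obtain ⟨A', hA'⟩ := A.neg.exists_positiveLang_LimSup_eq_neg
    refine ⟨A', fun w => ?_⟩
    change A.almostSureLang LimInf w = A'.positiveLang LimSup w
    rw [hA', A.neg.positiveLang_LimSup, A.neg_neg, neg_neg]
  · obtain ⟨A', hA'⟩ := A.exists_positiveLang_LimSup_eq_neg
    refine ⟨A'.neg, fun w => ?_⟩
    change A.positiveLang LimSup w = A'.neg.almostSureLang LimInf w
    rw [← neg_inj, ← hA', A'.positiveLang_LimSup]
  · obtain ⟨A', hA'⟩ := h Bool ProbWeightedAutomaton.detectTrue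
    exact A'.not_positiveLang_LimInf_eq_detectTrue hA'
  · obtain ⟨A', hA'⟩ := h Bool ProbWeightedAutomaton.detectTrue.neg
    -- Negating both automata turns this reduction into the one already excluded.
    refine A'.neg.not_positiveLang_LimInf_eq_detectTrue fun w => ?_
    have hw : ProbWeightedAutomaton.detectTrue.neg.positiveLang LimInf w =
      A'.almostSureLang LimSup w := hA' w
    rw [ProbWeightedAutomaton.positiveLang_LimInf, ProbWeightedAutomaton.neg_neg] at hw ⊢
    rw [← hw, neg_neg]
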